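/- A DFA consists of a set $Q$ of states, an alphabet $\Sigma$ (an arbitrary set) and a total transition function $Q\times\Sigma\to Q$, $(q,a)\mapsto qa$. For $S\subseteq Q$, $a \in \Sigma$ and a word $w\in\Sigma^*$, put $Sa=\{sa : s\in S\}$, $S\lambda=S$ for the empty word $\lambda$, and $S(xw)=(Sx)w$ for a letter $x$. The DFA synchronizes on $S$ if $|Sw|=1$ for some word $w$ (then $w$ is called a synchronizing word for $S$), and it is synchronizing if it synchronizes on $Q$. The Černý automaton $C_n$ has states $0,\dots,n-1$ and two letters: one maps $i$ to $i+1 \bmod n$ for all $i$; the other maps $n-1$ to $0$ and fixes every other state. For $2\le k\le n\le 5$ let $T(n,k)$ be given by the table $$\begin{array}{c|cccc} k & n=2 & n=3 & n=4 & n=5\\ \hline 2 & 1 & 3 & 6 & 10\\ 3 & & 4 & 8 & 13\\ 4 & & & 9 & 15\\ 5 & & & & 16\end{array}$$ **Theorem.** Let $2\le k\le n\le 5$. 1. If a DFA with $n$ states is not synchronizing, but synchronizes on a subset $S$ of its states with $|S|=k$, then the length of a shortest synchronizing word for $S$ is strictly less than $T(n,k)$. 2. $T(n,k)$ is the maximum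 subset synchronization length for DFAs with $n$ states and subsets of size $k$: it is the largest value that the length of a shortest synchronizing word for $S$ attains, over all DFAs with $n$ states (synchronizing or not) and all subsets $S$ of $k$ states on which the DFA synchronizes. 3. This maximum is attained by the Černý automaton: $T(n,k)$ is also the largest length of a shortest synchronizing word for $S$ in $C_n$, over all subsets $S$ of size $k$ (on which $C_n$ synchronizes). -/

import Mathlib

universe u v

/-- A deterministic finite automaton `(Q, A, ·)` as used for synchronization: a total transition
function, with no initial state and no accepting states. -/
structure SyncDFA (Q : Type*) (A : Type*) where
  /-- the transition function `q · a` -/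
  step : Q → A → Q

namespace SyncDFA

section Basic

variable {Q : Type u} {A : Type v}

/-- `S · a = {s · a | s ∈ S}` for a set of states `S` and a letter `a`. -/
def stepSet (M : SyncDFA Q A) (S : Set Q) (a : A) : Set Q :=
  (fun q => M.step q a) '' S

/-- `S · w` for a word `w`, read from left to right: `S · λ = S` and `S · (x w) = (S · x) · w`. -/
def evalSet (M : SyncDFA Q A) : Set Q → List A → Set Q
  | S, [] => S
  | S, x :: w => evalSet M (M.stepSet S x) w

/-- `M` synchronizes on `S` in `l` steps: some word `w` of length `l` has `|S · w| = 1`. -/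
def SynchronizesOnIn (M : SyncDFA Q A) (S : Set Q) (l : ℕ) : Prop :=
  ∃ w : List A, w.length = l ∧ (M.evalSet S w).ncard = 1

/-- `M` synchronizes on the set of states `S`. -/
def SynchronizesOn (M : SyncDFA Q A) (S : Set Q) : Prop :=
  ∃ l : ℕ, M.SynchronizesOnIn S l

/-- `M` is synchronizing: it synchronizes on the set of all states. -/
def Synchronizing (M : SyncDFA Q A) : Prop :=
  M.SynchronizesOn Set.univ

/-- `M` synchronizes on `S`, and `l` is the length of a shortest synchronizing word for `S`. -/
def IsSyncLength (M : SyncDFA Q A) (S : Set Q) (l : ℕ) : Prop :=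
  IsLeast {l : ℕ | M.SynchronizesOnIn S l} l

end Basic

/-- The subset synchronization lengths for `n` states and subset size `k`: the lengths of the
shortest synchronizing words for `S`, over all DFAs with `n` states (over any alphabet, whether or
not they are synchronizing) and all subsets `S` of `k` states on which the DFA synchronizes. -/
def subsetSyncLengths (n k : ℕ) : Set ℕ :=
  {l : ℕ | ∃ (Q : Type u) (A : Type v) (_ : Finite Q) (M : SyncDFA Q A) (S : Set Q),
    Nat.card Q = n ∧ S.ncard = k ∧ M.IsSyncLength S l}

/-- The Černý automaton with states `0, …, n - 1` and two letters: `true` is the cyclic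
permutation `i ↦ i + 1 (mod n)`; `false` sends `n - 1` to `0` and fixes all other states. -/
def cerny (n : ℕ) : SyncDFA (Fin n) Bool where
  step i a := if a = true ∨ (i : ℕ) + 1 = n then finRotate n i else i

/-- The table of subset synchronization lengths: `syncTable n k` is the entry for `n` states and
subsets of size `k`, where `2 ≤ k ≤ n ≤ 5` (all other values are irrelevant). -/
def syncTable : ℕ → ℕ → ℕ
  | 2, 2 => 1
  | 3, 2 => 3
  | 3, 3 => 4
  | 4, 2 => 6
  | 4, 3 => 8
  | 4, 4 => 9
  | 5, 2 => 10
  | 5, 3 => 13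
  | 5, 4 => 15
  | 5, 5 => 16
  | _, _ => 0

end SyncDFA

set_option linter.unusedSectionVars false

/-! Let `d S` be the length of a shortest synchronizing word for `S`, and `⊤` if there is none; a
set is live if `d S` is finite and dead otherwise. The upper bounds use only the properties in
`IsDist`: some letter lowers a positive finite distance by exactly one, no letter lowers it by more,
and `d` is monotone on nonempty sets. A live pair at distance `N` therefore leads through pairs at
distances `N, N - 1, ..., 1`, so `N` is at most the number of live pairs. This gives the row `k =
2`.

Suppose all pairs are live, with largest distance `p`. Merging a pair inside a larger set costs at
most `p` letters (`compress`), so a triple has distance at most `2 * p`, and a counterexample leaves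
few values of `p`. These are excluded by an exhaustive computation, `search`, whose soundness is
`Matches.search_false`. It distributes the pairs over the levels `1, ..., p` and keeps track of the
maps that can still be letters: no letter may lower a distance by two, and every live pair needs a
letter that takes it one level down. At the end a breadth-first search bounds the distance of the
triple or quadruple in question. The whole state set needs at most one letter more than its proper
subsets (`univ_le`).

A DFA that is not synchronizing has a dead pair (`live_of_pairs`). Live sets do not contain it, and
counting them makes the bounds strict. The hard case is that of triples among five states. Two dead
pairs leave a single case for the search (`triple_le_of_two_dead`). If the dead pair is unique,
every letter permutes it, so the live sets meeting it in one point keep this property until they are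
synchronized, and there are only twelve such pairs and triples (`cross_lt_twelve`).

The values are attained by explicit subsets of the Černý automaton, checked by computing all images
under words of a given length (`exists_cerny`). -/

namespace SyncSearch

/-! ### The search, with sets of letters as bitmasks. -/

/-- Bitmask of the codes `c < 3125` whose base-five digit number `z` is zero. -/
def zeroDigitMask : ℕ → ℕ
  -- The quotient is a geometric sum with one bit at each multiple of `5 ^ (z + 1)`; the factor `2 ^
  -- 5 ^ z - 1` widens each bit to a block of length `5 ^ z`.
  | 0 => (2 ^ 3125 - 1) / (2 ^ 5 - 1)
  | 1 => (2 ^ 3125 - 1) / (2 ^ 25 - 1) * (2 ^ 5 - 1)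
  | 2 => (2 ^ 3125 - 1) / (2 ^ 125 - 1) * (2 ^ 25 - 1)
  | 3 => (2 ^ 3125 - 1) / (2 ^ 625 - 1) * (2 ^ 125 - 1)
  | _ => 2 ^ 625 - 1

/-- Bitmask of the codes `c < 3125` whose base-five digit number `z` equals `w`. -/
def digitMask (z w : ℕ) : ℕ := zeroDigitMask z <<< (w * 5 ^ z)

/-- Bitmask of the letters mapping every point of `Z` into `W`. -/
def intoMask (Z W : List ℕ) : ℕ :=
  Z.foldr (fun z m => W.foldr (fun w m' => digitMask z w ||| m') 0 &&& m) (2 ^ 3125 - 1)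

/-- Bitmask of the letters mapping `Z` into some member of `Ws`. -/
def intoAnyMask (Z : List ℕ) (Ws : List (List ℕ)) : ℕ :=
  Ws.foldr (fun W m => intoMask Z W ||| m) 0

/-- The bits of `m` that are not bits of `b`. -/
def maskDiff (m b : ℕ) : ℕ := m ^^^ (m &&& b)

/-- All ways to split a list into two sublists, the first one of length at most `c`. -/
def splits {α : Type} : List α → ℕ → List (List α × List α)
  | [], _ => [([], [])]
  | x :: l, 0 => [([], x :: l)]
  | x :: l, c + 1 =>
    (splits l c).map (fun | (v, r) => (x :: v, r)) ++
      (splits l (c + 1)).map (fun | (v, r) => (v, x :: r))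

/-- `Z ⊆ W` for lists of points. -/
def subsetB (Z W : List ℕ) : Bool := Z.all fun z => W.any fun w => Nat.beq z w

def antitoneB : List ℕ → Bool
  | [] => true
  | a :: l => (match l with | [] => true | b :: _ => Nat.ble b a) && antitoneB l

/-- Refine the key of the points `i, i + 1, …` by their degrees in the set `v` of pairs. -/
def refineKey (v : List (List ℕ)) : ℕ → List ℕ → List ℕ
  | _, [] => []
  | i, a :: l =>
    (16 * a + v.foldr (fun y s => bif y.any (fun x => Nat.beq x i) then s + 1 else s) 0)
      :: refineKey v (i + 1) l

/-- Breadth-first search: does `Z` get a distance below the bound from the known steps? -/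
def bfs (Z : List ℕ) (st : List ℕ) :
    ℕ → List (List (List ℕ)) → List (List ℕ) → List (List ℕ × ℕ) → Bool
  | 0, _, _, _ => false
  | k + 1, Ds, new, acc =>
    let low := (Ds.headD []) ++ new
    low.any (fun w => subsetB Z w) ||
    (let acc' := acc.map fun | (T, g) => (T, intoAnyMask T low ||| g)
     -- Each `s` contains a letter of the automaton. If all members of `s` map `T` into sets at
     -- distance at most `t`, then `T` has distance at most `t + 1`.
     let hit : List ℕ × ℕ → Bool := fun | (_, g) => st.any fun s => Nat.beq (s &&& g) s
     bfs Z st k Ds.tail ((acc'.filter hit).map fun | (T, _) => T) (acc'.filter fun T => !hit T))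

/-- The parameters of a search. -/
structure Params where
  /-- the distinguished set -/
  Z : List ℕ
  /-- its distance -/
  lb : ℕ
  /-- lower bound for the distances of its pairs -/
  ml : ℕ
  /-- lower bound for the number of dead pairs -/
  dead : ℕ
  /-- whether dead pairs are excluded -/
  full : Bool
  /-- sets whose distances are bounded in the leaves -/
  big : List (List ℕ)

/-- All finite levels are fixed here, so `R` consists of the dead pairs, which no letter may send
into the last level `D`. -/
def leaf (P : Params) (m : ℕ) (Ds : List (List (List ℕ))) (D R : List (List ℕ)) (st : List ℕ) :
    Bool :=
  (P.full && !R.isEmpty) ||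
  (let m' := maskDiff m (R.foldr (fun y b => intoAnyMask y D ||| b) 0)
   let st' := st.map (fun s => s &&& m')
   st'.any (fun s => Nat.beq s 0) || bfs P.Z st' P.lb Ds [] (P.big.map fun T => (T, 0)))

/-- The search; `true` means that no distance function is compatible with the state. -/
def search (P : Params) :
    ℕ → ℕ → ℕ → List (List (List ℕ)) → List (List ℕ) → List (List ℕ) → List ℕ → List ℕ → Bool
  | 0, _, m, Ds, D, R, st, _ => leaf P m Ds D R st
  | k + 1, L, m, Ds, D, R, st, key =>
    -- `v` is the level `L + 1` and `r` the rest, which must still supply the `k` later levels and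
    -- the dead pairs.
    (splits R (R.length - (k + P.dead))).all fun
      | (v, r) => v.isEmpty ||
        (Nat.ble (L + 2) P.ml && v.any (fun y => subsetB y P.Z)) ||
        -- Symmetry breaking: only labellings with nonincreasing keys are followed.
        (let key' := refineKey v 0 key
         !antitoneB key' ||
         -- The forbidden letters map a set at distance at least `L + 2` into level `L`.
         (let b := r.foldr (fun y b => intoAnyMask y D ||| b) 0
          let b' := bif Nat.ble (L + 2) P.lb then intoAnyMask P.Z D ||| b else b
          let m' := maskDiff m b'
          st.any (fun t => Nat.beq (t &&& m') 0) ||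
          -- Each pair of the new level needs a permitted letter into the level below.
          (let st1 := v.map fun y => intoAnyMask y D
           st1.any (fun t => Nat.beq (t &&& m') 0) ||
           search P k (L + 1) m' (Ds ++ [v]) v r (st1 ++ st) key')))

def pairs5 : List (List ℕ) :=
  [[0, 1], [0, 2], [0, 3], [0, 4], [1, 2], [1, 3], [1, 4], [2, 3], [2, 4], [3, 4]]

def big5 : List (List ℕ) :=
  [[0, 1, 2], [0, 1, 3], [0, 1, 4], [0, 2, 3], [0, 2, 4], [0, 3, 4], [1, 2, 3], [1, 2, 4],
    [1, 3, 4], [2, 3, 4], [0, 1, 2, 3], [0, 1, 2, 4], [0, 1, 3, 4], [0, 2, 3, 4], [1, 2, 3, 4]]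

def singles5 : List (List ℕ) := [[0], [1], [2], [3], [4]]

/-! ### Correctness of the bitmasks and of the splittings. -/

theorem testBit_zeroDigitMask_aux : ∀ z < 5, ∀ i < 125, ∀ j < 25,
    (zeroDigitMask z).testBit (25 * i + j) = Nat.beq ((25 * i + j) / 5 ^ z % 5) 0 := by
  decide +kernel

theorem testBit_zeroDigitMask {z c : ℕ} (hz : z < 5) (hc : c < 3125) :
    (zeroDigitMask z).testBit c = Nat.beq (c / 5 ^ z % 5) 0 := by
  have := testBit_zeroDigitMask_aux z hz (c / 25) (by omega) (c % 25) (by omega)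
  rwa [Nat.div_add_mod] at this

theorem testBit_digitMask {z w c : ℕ} (hz : z < 5) (hw : w < 5) (hc : c < 3125) :
    (digitMask z w).testBit c = decide (c / 5 ^ z % 5 = w) := by
  unfold digitMask
  rw [Nat.testBit_shiftLeft, testBit_zeroDigitMask hz (by omega), Bool.eq_iff_iff]
  simp only [ge_iff_le, Bool.and_eq_true, decide_eq_true_eq, Nat.beq_eq]
  have h5 : 0 < 5 ^ z := by positivity
  rw [← Nat.le_div_iff_mul_le h5, Nat.mul_comm w, Nat.sub_mul_div]
  generalize c / 5 ^ z = x
  omega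

theorem testBit_maskDiff (m b c : ℕ) :
    (maskDiff m b).testBit c = (m.testBit c && !b.testBit c) := by
  unfold maskDiff
  rw [Nat.testBit_xor, Nat.testBit_and]
  cases m.testBit c <;> cases b.testBit c <;> rfl

theorem mem_splits {α : Type} (p : α → Bool) (l : List α) (c : ℕ) (h : (l.filter p).length ≤ c) :
    (l.filter p, l.filter fun x => !p x) ∈ splits l c := by
  induction l generalizing c with
  | nil => simp [splits]
  | cons x l ih =>
    cases hx : p x with
    | true =>
      simp only [List.filter_cons, hx, if_true, List.length_cons] at h
      obtain ⟨c, rfl⟩ : ∃ c', c = c' + 1 := ⟨c - 1, by omega⟩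
      have := ih c (by omega)
      simp only [splits, List.mem_append, List.mem_map]
      exact Or.inl ⟨_, this, by simp [hx]⟩
    | false =>
      simp only [List.filter_cons, hx, Bool.false_eq_true, if_false] at h
      have := ih c h
      cases c with
      | zero =>
        have h0 : l.filter p = [] := List.length_eq_zero_iff.1 (by omega)
        have h1 : l.filter (fun x => !p x) = l := by
          rw [List.filter_eq_self]
          intro a ha
          rw [List.filter_eq_nil_iff] at h0
          simpa using h0 a ha
        simp [splits, hx, h0, h1]
      | succ c =>
        simp only [splits, List.mem_append, List.mem_map]
        exact Or.inr ⟨_, this, by simp [hx]⟩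

theorem subsetB_iff {Z W : List ℕ} : subsetB Z W = true ↔ ∀ z ∈ Z, z ∈ W := by
  simp [subsetB]

section Letters

variable {Q : Type*} {n : ℕ} (e : Q ≃ Fin n)

/-- The image of the point with number `i` under the letter `f`, as a number. -/
def digit (f : Q → Q) (i : ℕ) : ℕ := if h : i < n then e (f (e.symm ⟨i, h⟩)) else 0

/-- The code of a letter. -/
def code (f : Q → Q) : ℕ :=
  digit e f 0 + 5 * digit e f 1 + 25 * digit e f 2 + 125 * digit e f 3 + 625 * digit e f 4

/-- The set of the points whose numbers are listed. -/
def pts (l : List ℕ) : Set Q := {q | (e q : ℕ) ∈ l}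

theorem digit_lt (hn : n ≤ 5) (f : Q → Q) (i : ℕ) : digit e f i < 5 := by
  unfold digit
  split
  · exact lt_of_lt_of_le (Fin.is_lt _) hn
  · norm_num

theorem code_div_mod (hn : n ≤ 5) (f : Q → Q) {z : ℕ} (hz : z < 5) :
    code e f / 5 ^ z % 5 = digit e f z := by
  have h0 := digit_lt e hn f 0
  have h1 := digit_lt e hn f 1
  have h2 := digit_lt e hn f 2
  have h3 := digit_lt e hn f 3
  have h4 := digit_lt e hn f 4
  unfold code
  interval_cases z <;> norm_num <;> omega

theorem code_lt (hn : n ≤ 5) (f : Q → Q) : code e f < 3125 := by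
  have h0 := digit_lt e hn f 0
  have h1 := digit_lt e hn f 1
  have h2 := digit_lt e hn f 2
  have h3 := digit_lt e hn f 3
  have h4 := digit_lt e hn f 4
  unfold code
  omega

theorem testBit_intoMask (hn : n ≤ 5) (f : Q → Q) {Z W : List ℕ} (hZ : ∀ z ∈ Z, z < n)
    (hW : ∀ w ∈ W, w < n) :
    (intoMask Z W).testBit (code e f) = true ↔ Set.MapsTo f (pts e Z) (pts e W) := by
  have key : (intoMask Z W).testBit (code e f) = true ↔ ∀ z ∈ Z, digit e f z ∈ W := by
    unfold intoMask
    induction Z with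
    | nil => simp [-Nat.reducePow, -Nat.reduceSub, Nat.testBit_two_pow_sub_one, code_lt e hn f]
    | cons z Z ih =>
      rw [List.foldr_cons, Nat.testBit_and, Bool.and_eq_true,
        ih fun x hx => hZ x (List.mem_cons_of_mem _ hx), List.forall_mem_cons]
      refine and_congr_left fun h => ?_
      have hz : z < 5 := lt_of_lt_of_le (hZ z List.mem_cons_self) hn
      clear ih h
      induction W with
      | nil => simp
      | cons w W ihW =>
        have hw : w < 5 := lt_of_lt_of_le (hW w List.mem_cons_self) hn
        have ih' := ihW fun x hx => hW x (List.mem_cons_of_mem _ hx)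
        rw [List.foldr_cons, Nat.testBit_or, Bool.or_eq_true, List.mem_cons,
          testBit_digitMask hz hw (code_lt e hn f), code_div_mod e hn f hz, decide_eq_true_eq]
        exact or_congr_right ih'
  rw [key]
  constructor
  · intro h q hq
    have := h _ hq
    simpa [digit, pts] using this
  · intro h z hz
    have hq : e.symm ⟨z, hZ z hz⟩ ∈ pts e Z := by simpa [pts] using hz
    simpa [digit, pts, hZ z hz] using h hq

theorem testBit_intoAnyMask (hn : n ≤ 5) (f : Q → Q) {Z : List ℕ} {Ws : List (List ℕ)}
    (hZ : ∀ z ∈ Z, z < n) (hW : ∀ W ∈ Ws, ∀ w ∈ W, w < n) :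
    (intoAnyMask Z Ws).testBit (code e f) = true ↔
      ∃ W ∈ Ws, Set.MapsTo f (pts e Z) (pts e W) := by
  unfold intoAnyMask
  induction Ws with
  | nil => simp
  | cons W Ws ih =>
    rw [List.foldr_cons, Nat.testBit_or, Bool.or_eq_true,
      ih fun x hx => hW x (List.mem_cons_of_mem _ hx),
      testBit_intoMask e hn f hZ (hW W List.mem_cons_self), List.exists_mem_cons_iff]

end Letters

/-! ### Distance functions and soundness of the search. -/

/-- The axioms of the map `d` from sets of states to the lengths of their shortest synchronizing
words, where `F` is the set of the maps induced by the letters. -/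
structure IsDist {Q : Type*} (F : Set (Q → Q)) (d : Set Q → ℕ∞) : Prop where
  singleton (q : Q) : d {q} = 0
  eq_singleton (S : Set Q) : d S = 0 → ∃ q, S = {q}
  -- The empty set is never synchronized, so it has distance `⊤` and must be excluded.
  mono (S T : Set Q) : S.Nonempty → S ⊆ T → d S ≤ d T
  step (f : Q → Q) (S : Set Q) : f ∈ F → d S ≤ d (f '' S) + 1
  exists_step (S : Set Q) (k : ℕ) : d S = k + 1 → ∃ f ∈ F, d (f '' S) = k

theorem IsDist.le_add_one {Q : Type*} {F : Set (Q → Q)} {d : Set Q → ℕ∞} (hd : IsDist F d)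
    {f : Q → Q} (hf : f ∈ F) {S T : Set Q} (hS : S.Nonempty) (h : Set.MapsTo f S T) :
    d S ≤ d T + 1 :=
  (hd.step f S hf).trans
    (add_le_add_left (hd.mono _ _ (hS.image f) (Set.mapsTo_iff_image_subset.1 h)) 1)

section Soundness

variable {Q : Type*} {n : ℕ} (e : Q ≃ Fin n) (d : Set Q → ℕ∞) (pairs singles : List (List ℕ))

open Classical in
/-- The listed sets at distance `j`: the singletons for `j = 0`, and pairs for `j > 0`. -/
noncomputable def level (j : ℕ) : List (List ℕ) :=
  if j = 0 then singles else pairs.filter fun y => d (pts e y) = j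

open Classical in
/-- The pairs whose distances exceed `j`. -/
noncomputable def above (j : ℕ) : List (List ℕ) :=
  pairs.filter fun y => (j : ℕ∞) < d (pts e y)

/-- The key after `j` refinements. -/
noncomputable def keyAt (key : List ℕ) : ℕ → List ℕ
  | 0 => key
  | j + 1 => refineKey (level e d pairs singles (j + 1)) 0 (keyAt key j)

/-- A distance function matches the parameters of a search with pairs up to distance `p`. -/
structure Matches (F : Set (Q → Q)) (P : Params) (p : ℕ) (key : List ℕ) : Prop where
  isDist : IsDist F d
  le_five : n ≤ 5
  singles_lt : ∀ y ∈ singles, ∀ x ∈ y, x < n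
  singles_dist : ∀ y ∈ singles, d (pts e y) = 0
  pairs_lt : ∀ y ∈ pairs, y ≠ [] ∧ ∀ x ∈ y, x < n
  Z_lt : P.Z ≠ [] ∧ ∀ x ∈ P.Z, x < n
  big_lt : ∀ y ∈ P.big, y ≠ [] ∧ ∀ x ∈ y, x < n
  lb_le : (P.lb : ℕ∞) ≤ d (pts e P.Z)
  ml_le : ∀ y ∈ pairs, subsetB y P.Z = true → (P.ml : ℕ∞) ≤ d (pts e y)
  full : P.full = true → ∀ y ∈ pairs, d (pts e y) ≠ ⊤
  le_top : ∀ y ∈ pairs, (p : ℕ∞) < d (pts e y) → d (pts e y) = ⊤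
  exists_level : ∀ j, 1 ≤ j → j ≤ p → ∃ y ∈ pairs, d (pts e y) = j
  dead_le : P.dead ≤ (above e d pairs p).length
  pair_step : ∀ y ∈ pairs, ∀ j : ℕ, d (pts e y) = (j + 1 : ℕ) →
    ∃ f ∈ F, ∃ w ∈ level e d pairs singles j, Set.MapsTo f (pts e y) (pts e w)
  key_anti : ∀ j ≤ p, antitoneB (keyAt e d pairs singles key j) = true

variable {e d pairs singles} {F : Set (Q → Q)} {P : Params} {p : ℕ} {key : List ℕ}

theorem pts_nonempty {y : List ℕ} (h : y ≠ [] ∧ ∀ x ∈ y, x < n) : (pts e y).Nonempty := by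
  obtain ⟨x, hx⟩ := List.exists_mem_of_ne_nil y h.1
  exact ⟨e.symm ⟨x, h.2 x hx⟩, by simpa [pts] using hx⟩

theorem pts_mono {y z : List ℕ} (h : subsetB y z = true) : pts e y ⊆ pts e z :=
  fun _ hq => subsetB_iff.1 h _ hq

theorem mem_above {j : ℕ} {y : List ℕ} :
    y ∈ above e d pairs j ↔ y ∈ pairs ∧ (j : ℕ∞) < d (pts e y) := by
  simp [above]

namespace Matches

variable (h : Matches e d pairs singles F P p key)

include h

theorem level_dist {j : ℕ} {y : List ℕ} (hy : y ∈ level e d pairs singles j) :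
    d (pts e y) = j := by
  unfold level at hy
  split at hy
  · rename_i hj
    simpa [hj] using h.singles_dist y hy
  · simpa using (List.mem_filter.1 hy).2

theorem level_lt {j : ℕ} {y : List ℕ} (hy : y ∈ level e d pairs singles j) : ∀ x ∈ y, x < n := by
  unfold level at hy
  split at hy
  · exact h.singles_lt y hy
  · exact (h.pairs_lt y (List.mem_filter.1 hy).1).2

/-- Each of the `k` levels `L + 1, ..., p` contains a pair, and the dead pairs lie above them all.
-/
theorem length_above {k L : ℕ} (hkL : L + k = p) : k + P.dead ≤ (above e d pairs L).length := by
  induction k generalizing L with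
  | zero => subst hkL; simpa using h.dead_le
  | succ k ih =>
    obtain ⟨y, hy, hyd⟩ := h.exists_level (L + 1) (by omega) (by omega)
    have h1 := ih (L := L + 1) (by omega)
    suffices (above e d pairs (L + 1)).length < (above e d pairs L).length by omega
    classical
    have hsub : above e d pairs (L + 1) = (above e d pairs L).filter
        (fun y => ((L + 1 : ℕ) : ℕ∞) < d (pts e y)) := by
      unfold above
      rw [List.filter_filter]
      refine List.filter_congr fun x _ => ?_
      by_cases hx : ((L + 1 : ℕ) : ℕ∞) < d (pts e x)
      · have : (L : ℕ∞) < d (pts e x) := lt_trans (by exact_mod_cast Nat.lt_succ_self L) hx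
        simp [this]
      · simp only [hx, decide_false, Bool.false_and]
    rw [hsub, List.length_filter_lt_length_iff_exists]
    refine ⟨y, mem_above.2 ⟨hy, ?_⟩, ?_⟩
    · rw [hyd]; exact_mod_cast Nat.lt_succ_self L
    · rw [hyd]; simp

theorem split_mem {k L : ℕ} (hkL : L + (k + 1) = p) :
    (level e d pairs singles (L + 1), above e d pairs (L + 1)) ∈
      splits (above e d pairs L) ((above e d pairs L).length - (k + P.dead)) := by
  classical
  let q : List ℕ → Bool := fun y => d (pts e y) = (L + 1 : ℕ)
  have h1 : (above e d pairs L).filter q = level e d pairs singles (L + 1) := by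
    unfold above level
    rw [List.filter_filter, if_neg (Nat.succ_ne_zero L)]
    refine List.filter_congr fun x _ => ?_
    by_cases hx : d (pts e x) = (L + 1 : ℕ)
    · have : (L : ℕ∞) < d (pts e x) := by rw [hx]; exact_mod_cast Nat.lt_succ_self L
      simp [q, hx]
      exact_mod_cast Nat.lt_succ_self L
    · simp only [q, hx, decide_false, Bool.false_and]
  have h2 : (above e d pairs L).filter (fun y => !q y) = above e d pairs (L + 1) := by
    unfold above
    rw [List.filter_filter]
    refine List.filter_congr fun x _ => ?_
    rw [Bool.eq_iff_iff]
    simp only [q, Bool.and_eq_true, Bool.not_eq_true', decide_eq_false_iff_not, decide_eq_true_eq]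
    cases hx : d (pts e x) with
    | top => simpa using (ENat.top_ne_natCast (L + 1))
    | coe a =>
      norm_cast
      omega
  rw [← h1, ← h2]
  apply mem_splits
  have h3 := h.length_above (k := k) (L := L + 1) (by omega)
  rw [← h2] at h3
  have h4 := List.length_eq_length_filter_add (l := above e d pairs L) q
  omega

/-- Otherwise a single letter would lower the distance of `Z` by at least two. -/
theorem not_intoAnyMask {f : Q → Q} (hf : f ∈ F) {Z : List ℕ} (hZ : Z ≠ [] ∧ ∀ x ∈ Z, x < n)
    {L : ℕ} (hL : ((L + 1 : ℕ) : ℕ∞) < d (pts e Z)) :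
    (intoAnyMask Z (level e d pairs singles L)).testBit (code e f) = false := by
  rw [← Bool.not_eq_true, testBit_intoAnyMask e h.le_five f hZ.2 fun W hW => h.level_lt hW]
  rintro ⟨W, hW, hm⟩
  have := h.isDist.le_add_one hf (pts_nonempty hZ) hm
  rw [h.level_dist hW] at this
  exact absurd (lt_of_lt_of_le hL this) (by simp)

omit h in
theorem testBit_foldr_above {f : Q → Q} {D : List (List ℕ)} {R : List (List ℕ)}
    (hR : ∀ y ∈ R, (intoAnyMask y D).testBit (code e f) = false) :
    (R.foldr (fun y b => intoAnyMask y D ||| b) 0).testBit (code e f) = false := by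
  induction R with
  | nil => simp
  | cons y R ih =>
    rw [List.foldr_cons, Nat.testBit_or, hR y List.mem_cons_self,
      ih fun x hx => hR x (List.mem_cons_of_mem _ hx)]
    rfl

/-- Invariant at time `t`: `Ds` starts with level `t`, the sets in `new` have distance at most `t`,
and a letter of the automaton in the mask stored with `T` certifies distance at most `t + 1`.
Finding a superset of `Z` at a time `t < P.lb` would contradict `lb_le`. -/
theorem bfs_false {st : List ℕ} (hst : ∀ s ∈ st, ∃ f ∈ F, s.testBit (code e f) = true)
    (k t : ℕ) (Ds : List (List (List ℕ))) (new : List (List ℕ)) (acc : List (List ℕ × ℕ))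
    (hkt : t + k ≤ P.lb)
    (hDs : ∀ i, ∀ w ∈ Ds.getD i [], (∀ x ∈ w, x < n) ∧ d (pts e w) ≤ (t + i : ℕ))
    (hnew : ∀ w ∈ new, (∀ x ∈ w, x < n) ∧ d (pts e w) ≤ t)
    (hacc : ∀ T ∈ acc, (T.1 ≠ [] ∧ ∀ x ∈ T.1, x < n) ∧
      ∀ f ∈ F, T.2.testBit (code e f) = true → d (pts e T.1) ≤ (t + 1 : ℕ)) :
    bfs P.Z st k Ds new acc = false := by
  induction k generalizing t Ds new acc with
  | zero => rfl
  | succ k ih =>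
    have hlow : ∀ w ∈ Ds.headD [] ++ new, (∀ x ∈ w, x < n) ∧ d (pts e w) ≤ t := by
      intro w hw
      rcases List.mem_append.1 hw with hw | hw
      · have := hDs 0 w (by cases Ds <;> simp at hw ⊢ <;> exact hw)
        simpa using this
      · exact hnew w hw
    have hacc' : ∀ T ∈ acc.map (fun | (T, g) => (T, intoAnyMask T (Ds.headD [] ++ new) ||| g)),
        (T.1 ≠ [] ∧ ∀ x ∈ T.1, x < n) ∧
          ∀ f ∈ F, T.2.testBit (code e f) = true → d (pts e T.1) ≤ (t + 1 : ℕ) := by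
      intro T' hT'
      obtain ⟨⟨T, g⟩, hT, rfl⟩ := List.mem_map.1 hT'
      refine ⟨(hacc _ hT).1, fun f hf hb => ?_⟩
      rw [Nat.testBit_or, Bool.or_eq_true,
        testBit_intoAnyMask e h.le_five f (hacc _ hT).1.2 fun W hW => (hlow W hW).1] at hb
      rcases hb with ⟨W, hW, hm⟩ | hb
      · have := h.isDist.le_add_one hf (pts_nonempty (hacc _ hT).1) hm
        refine this.trans ?_
        push_cast
        exact add_le_add_left (hlow W hW).2 1
      · exact (hacc _ hT).2 f hf hb
    unfold bfs
    simp only [Bool.or_eq_false_iff]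
    constructor
    · rw [List.any_eq_false]
      intro w hw hs
      have h1 := h.isDist.mono _ _ (pts_nonempty h.Z_lt) (pts_mono (e := e) hs)
      have h2 := (h.lb_le.trans h1).trans (hlow w hw).2
      have : P.lb ≤ t := by exact_mod_cast h2
      omega
    · apply ih (t + 1) _ _ _ (by omega)
      · intro i w hw
        have := hDs (i + 1) w (by cases Ds <;> simp at hw ⊢ <;> exact hw)
        rwa [show t + 1 + i = t + (i + 1) by omega]
      · intro w hw
        obtain ⟨⟨T, g⟩, hT, rfl⟩ := List.mem_map.1 hw
        obtain ⟨hT, hhit⟩ := List.mem_filter.1 hT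
        refine ⟨(hacc' _ hT).1.2, ?_⟩
        obtain ⟨s, hs, hsg⟩ := List.any_eq_true.1 hhit
        obtain ⟨f, hf, hb⟩ := hst s hs
        refine (hacc' _ hT).2 f hf ?_
        rw [← Nat.eq_of_beq_eq_true hsg, Nat.testBit_and, Bool.and_eq_true] at hb
        exact hb.2
      · intro T hT
        obtain ⟨hT, -⟩ := List.mem_filter.1 hT
        refine ⟨(hacc' _ hT).1, fun f hf hb => ((hacc' _ hT).2 f hf hb).trans ?_⟩
        exact_mod_cast Nat.le_succ _

omit h in
theorem beq_and_zero {s m : ℕ} {f : Q → Q} (hs : s.testBit (code e f) = true)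
    (hm : m.testBit (code e f) = true) : ¬ Nat.beq (s &&& m) 0 = true := by
  intro h0
  have h1 : (s &&& m).testBit (code e f) = true := by
    rw [Nat.testBit_and, hs, hm, Bool.and_self]
  rw [Nat.eq_of_beq_eq_true h0] at h1
  simp at h1

theorem leaf_false {m : ℕ} {st : List ℕ} (hm : ∀ f ∈ F, m.testBit (code e f) = true)
    (hst : ∀ s ∈ st, ∃ f ∈ F, s.testBit (code e f) = true) :
    leaf P m ((List.range (p + 1)).map (level e d pairs singles)) (level e d pairs singles p)
      (above e d pairs p) st = false := by
  unfold leaf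
  have hm' : ∀ f ∈ F, (maskDiff m ((above e d pairs p).foldr
      (fun y b => intoAnyMask y (level e d pairs singles p) ||| b) 0)).testBit (code e f)
      = true := by
    intro f hf
    rw [testBit_maskDiff, hm f hf, testBit_foldr_above]
    · rfl
    · intro y hy
      rw [mem_above] at hy
      refine h.not_intoAnyMask hf (h.pairs_lt y hy.1) ?_
      rw [h.le_top y hy.1 hy.2]
      exact ENat.natCast_lt_top _
  simp only [Bool.or_eq_false_iff]
  refine ⟨?_, ?_, ?_⟩
  · cases hfull : P.full
    · rfl
    · have : above e d pairs p = [] := by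
        rw [List.eq_nil_iff_forall_not_mem]
        intro y hy
        rw [mem_above] at hy
        exact h.full hfull y hy.1 (h.le_top y hy.1 hy.2)
      simp [this]
  · rw [List.any_eq_false]
    intro s hs
    obtain ⟨s, hs0, rfl⟩ := List.mem_map.1 hs
    obtain ⟨f, hf, hb⟩ := hst s hs0
    have h1 := beq_and_zero hb (hm' f hf)
    exact h1
  · refine h.bfs_false ?_ P.lb 0 _ _ _ (by omega) ?_ ?_ ?_
    · intro s hs
      obtain ⟨s, hs0, rfl⟩ := List.mem_map.1 hs
      obtain ⟨f, hf, hb⟩ := hst s hs0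
      exact ⟨f, hf, by rw [Nat.testBit_and, hb, hm' f hf, Bool.and_self]⟩
    · intro i w hw
      rw [List.getD_eq_getElem?_getD, List.getElem?_map] at hw
      by_cases hi : i < p + 1
      · rw [List.getElem?_range hi] at hw
        simp only [Option.map_some, Option.getD_some] at hw
        exact ⟨h.level_lt hw, by rw [h.level_dist hw]; simp⟩
      · rw [List.getElem?_eq_none (by simpa using hi)] at hw
        simp at hw
    · simp
    · intro T hT
      obtain ⟨T, hT0, rfl⟩ := List.mem_map.1 hT
      exact ⟨h.big_lt T hT0, fun f _ hb => by simp at hb⟩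

/-- The actual distance function singles out one branch: its split is among those tried at each
level, and no pruning test succeeds on it. -/
theorem search_false (k L m : ℕ) (st : List ℕ) (hkL : L + k = p)
    (hm : ∀ f ∈ F, m.testBit (code e f) = true)
    (hst : ∀ s ∈ st, ∃ f ∈ F, s.testBit (code e f) = true) :
    search P k L m ((List.range (L + 1)).map (level e d pairs singles)) (level e d pairs singles L)
      (above e d pairs L) st (keyAt e d pairs singles key L) = false := by
  induction k generalizing L m st with
  | zero =>
    obtain rfl : L = p := by omega
    exact h.leaf_false hm hst
  | succ k ih =>
    unfold search
    rw [List.all_eq_false]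
    refine ⟨_, h.split_mem hkL, ?_⟩
    simp only [Bool.not_eq_true, Bool.or_eq_false_iff]
    have hm' : ∀ f ∈ F, (maskDiff m (bif Nat.ble (L + 2) P.lb then
        intoAnyMask P.Z (level e d pairs singles L) ||| (above e d pairs (L + 1)).foldr
          (fun y b => intoAnyMask y (level e d pairs singles L) ||| b) 0
        else (above e d pairs (L + 1)).foldr
          (fun y b => intoAnyMask y (level e d pairs singles L) ||| b) 0)).testBit (code e f)
        = true := by
      intro f hf
      have h1 := testBit_foldr_above (f := f) (D := level e d pairs singles L)
        (R := above e d pairs (L + 1)) (fun y hy => by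
          rw [mem_above] at hy
          exact h.not_intoAnyMask hf (h.pairs_lt y hy.1) hy.2)
      rw [testBit_maskDiff, hm f hf]
      cases hlb : Nat.ble (L + 2) P.lb
      · simp only [cond_false, h1]; rfl
      · have h2 := h.not_intoAnyMask hf h.Z_lt (L := L) (lt_of_lt_of_le
          (by exact_mod_cast (Nat.le_of_ble_eq_true hlb : L + 1 < P.lb)) h.lb_le)
        simp only [cond_true, Nat.testBit_or, h1, h2]; rfl
    have hst1 : ∀ s ∈ (level e d pairs singles (L + 1)).map
        (fun y => intoAnyMask y (level e d pairs singles L)),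
        ∃ f ∈ F, s.testBit (code e f) = true := by
      intro s hs
      obtain ⟨y, hy, rfl⟩ := List.mem_map.1 hs
      have hyp : y ∈ pairs := by
        rw [level, if_neg (Nat.succ_ne_zero L)] at hy
        exact (List.mem_filter.1 hy).1
      obtain ⟨f, hf, w, hw, hmw⟩ := h.pair_step y hyp L (h.level_dist hy)
      refine ⟨f, hf, ?_⟩
      rw [testBit_intoAnyMask e h.le_five f (h.pairs_lt y hyp).2 fun W hW => h.level_lt hW]
      exact ⟨w, hw, hmw⟩
    have hany : ∀ st' : List ℕ, (∀ s ∈ st', ∃ f ∈ F, s.testBit (code e f) = true) →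
        ∀ m', (∀ f ∈ F, m'.testBit (code e f) = true) →
        (st'.any fun t => Nat.beq (t &&& m') 0) = false := by
      intro st' hst' m' hm''
      rw [List.any_eq_false]
      intro s hs
      obtain ⟨f, hf, hb⟩ := hst' s hs
      exact beq_and_zero hb (hm'' f hf)
    refine ⟨⟨?_, ?_⟩, ?_, hany _ hst _ hm', hany _ hst1 _ hm', ?_⟩
    · obtain ⟨y, hy, hyd⟩ := h.exists_level (L + 1) (by omega) (by omega)
      rw [List.isEmpty_eq_false_iff_exists_mem]
      refine ⟨y, ?_⟩
      rw [level, if_neg (Nat.succ_ne_zero L)]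
      exact List.mem_filter.2 ⟨hy, by simpa using hyd⟩
    · rw [Bool.and_eq_false_iff]
      by_cases hb : Nat.ble (L + 2) P.ml = true
      · right
        rw [List.any_eq_false]
        intro y hy hs
        have hyp : y ∈ pairs := by
          rw [level, if_neg (Nat.succ_ne_zero L)] at hy
          exact (List.mem_filter.1 hy).1
        have h1 := h.ml_le y hyp hs
        rw [h.level_dist hy] at h1
        have h2 : P.ml ≤ L + 1 := by exact_mod_cast h1
        have := Nat.le_of_ble_eq_true hb
        omega
      · left; rwa [Bool.not_eq_true] at hb
    · have := h.key_anti (L + 1) (by omega)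
      rw [keyAt] at this
      simp [this]
    · have hih := ih (L + 1) _ ((level e d pairs singles (L + 1)).map
        (fun y => intoAnyMask y (level e d pairs singles L)) ++ st) (by omega) hm' (fun s hs => ?_)
      · rw [List.range_succ, List.map_append, keyAt] at hih
        exact hih
      · rcases List.mem_append.1 hs with hs | hs
        · exact hst1 s hs
        · exact hst s hs

end Matches

end Soundness

/-! ### Chains of distances and compression of sets. -/

section Theory

variable {Q : Type*} [Fintype Q] [DecidableEq Q] {F : Set (Q → Q)} {d : Set Q → ℕ∞}

namespace IsDist

variable (hd : IsDist F d)

include hd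

theorem exists_image (s : Finset Q) (k : ℕ) (h : d s = (k + 1 : ℕ)) :
    ∃ f ∈ F, d (s.image f : Finset Q) = k := by
  obtain ⟨f, hf, hk⟩ := hd.exists_step s k (by simpa using h)
  exact ⟨f, hf, by simpa using hk⟩

theorem le_image (s : Finset Q) {f : Q → Q} (hf : f ∈ F) :
    d s ≤ d (s.image f : Finset Q) + 1 := by
  simpa using hd.step f s hf

theorem nonempty (s : Finset Q) (k : ℕ) (h : d s = k) : s.Nonempty := by
  induction k generalizing s with
  | zero =>
    obtain ⟨q, hq⟩ := hd.eq_singleton s (by simpa using h)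
    exact ⟨q, by simpa using hq.symm.subset rfl⟩
  | succ k ih =>
    obtain ⟨f, -, hk⟩ := hd.exists_image s k h
    exact Finset.image_nonempty.1 (ih _ hk)

theorem two_le_card {s : Finset Q} (hs : s.Nonempty) (h : d s ≠ 0) : 2 ≤ s.card := by
  by_contra hc
  have : s.card = 1 := by have := hs.card_pos; omega
  obtain ⟨q, rfl⟩ := Finset.card_eq_one.1 this
  exact h (by simpa using hd.singleton q)

theorem ne_zero {s : Finset Q} (h : 2 ≤ s.card) : d s ≠ 0 := by
  intro h0
  obtain ⟨q, hq⟩ := hd.eq_singleton s h0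
  have : s = {q} := by exact_mod_cast hq
  simp [this] at h

theorem eq_zero {s : Finset Q} (h : s.card = 1) : d s = 0 := by
  obtain ⟨q, rfl⟩ := Finset.card_eq_one.1 h
  simpa using hd.singleton q

theorem mono' {s t : Finset Q} (hs : s.Nonempty) (h : s ⊆ t) : d s ≤ d t :=
  hd.mono _ _ (by simpa using hs) (by simpa using h)

/-- In a family of sets that contains a successor of each of its members, all smaller
distances occur. -/
theorem exists_dist_eq {C : Finset (Finset Q)}
    (hC : ∀ s ∈ C, ∀ k : ℕ, 1 ≤ k → d s = (k + 1 : ℕ) → ∃ t ∈ C, d t = k)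
    {s : Finset Q} (hs : s ∈ C) {N : ℕ} (hN : d s = N) (j : ℕ) (h1 : 1 ≤ j) (hj : j ≤ N) :
    ∃ t ∈ C, d t = j := by
  induction N generalizing s with
  | zero => omega
  | succ N ih =>
    rcases Nat.eq_or_lt_of_le hj with rfl | hlt
    · exact ⟨s, hs, hN⟩
    · obtain ⟨t, ht, hk⟩ := hC s hs N (by omega) hN
      exact ih ht hk (by omega)

/-- By `exists_dist_eq`, all of `1, ..., N` occur as distances of members of `C`. -/
theorem le_card_image {C : Finset (Finset Q)}
    (hC : ∀ s ∈ C, ∀ k : ℕ, 1 ≤ k → d s = (k + 1 : ℕ) → ∃ t ∈ C, d t = k)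
    {s : Finset Q} (hs : s ∈ C) {N : ℕ} (hN : d s = N) :
    N ≤ ((C.filter fun t : Finset Q => d t ≠ ⊤).image fun t : Finset Q => d t).card := by
  have h1 : ((Finset.Icc 1 N).image fun j : ℕ => (j : ℕ∞)).card = N := by
    rw [Finset.card_image_of_injective _ Nat.cast_injective]
    simp
  rw [← h1]
  refine Finset.card_le_card fun x hx => ?_
  obtain ⟨j, hj, rfl⟩ := Finset.mem_image.1 hx
  rw [Finset.mem_Icc] at hj
  obtain ⟨t, ht, htj⟩ := hd.exists_dist_eq hC hs hN j hj.1 hj.2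
  exact Finset.mem_image.2 ⟨t, Finset.mem_filter.2 ⟨ht, by simp [htj]⟩, htj⟩

theorem le_card_live {C : Finset (Finset Q)}
    (hC : ∀ s ∈ C, ∀ k : ℕ, 1 ≤ k → d s = (k + 1 : ℕ) → ∃ t ∈ C, d t = k)
    {s : Finset Q} (hs : s ∈ C) {N : ℕ} (hN : d s = N) :
    N ≤ (C.filter fun t : Finset Q => d t ≠ ⊤).card :=
  (hd.le_card_image hC hs hN).trans Finset.card_image_le

/-- An image at positive distance is not a singleton, so the pairs form a family as in
`exists_dist_eq`. -/
theorem exists_pair (s : Finset Q) (hs : s ∈ Finset.powersetCard 2 (Finset.univ : Finset Q))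
    (k : ℕ) (h1 : 1 ≤ k) (h : d s = (k + 1 : ℕ)) :
    ∃ t ∈ Finset.powersetCard 2 (Finset.univ : Finset Q), d t = k := by
  obtain ⟨f, -, hk⟩ := hd.exists_image s k h
  refine ⟨_, ?_, hk⟩
  have hs2 : s.card = 2 := by simpa [Finset.mem_powersetCard] using hs
  have h2 : 2 ≤ (s.image f).card := hd.two_le_card (hd.nonempty _ k hk) (by
    rw [hk]; exact_mod_cast (by omega : k ≠ 0))
  have h3 := Finset.card_image_le (s := s) (f := f)
  simp only [Finset.mem_powersetCard, Finset.subset_univ, true_and]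
  omega

/-- The distance of a pair is at most the number of live pairs. -/
theorem pair_le {s : Finset Q} (hs : s.card = 2) {N : ℕ} (hN : d s = N) :
    N ≤ ((Finset.powersetCard 2 Finset.univ).filter fun t : Finset Q => d t ≠ ⊤).card :=
  hd.le_card_live hd.exists_pair (by simpa [Finset.mem_powersetCard] using hs) hN

/-- Apply a shortest word for `E` letter by letter: `s` loses a point no later than `E` does, and
`E` becomes a singleton within `k` letters. -/
theorem compress {k : ℕ} {E s : Finset Q} (hE : 2 ≤ E.card) (hEs : E ⊆ s) (h : d E = k) :
    ∃ t : Finset Q, t.Nonempty ∧ t.card < s.card ∧ d s ≤ d t + k := by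
  induction k generalizing E s with
  | zero => exact absurd (by simpa using h) (hd.ne_zero hE)
  | succ k ih =>
    obtain ⟨f, hf, hk⟩ := hd.exists_image E k h
    have hsf : d s ≤ d (s.image f : Finset Q) + 1 := hd.le_image s hf
    have hsub : E.image f ⊆ s.image f := Finset.image_subset_image hEs
    have hcard : (s.image f).card ≤ s.card := Finset.card_image_le
    by_cases h2 : 2 ≤ (E.image f).card
    · obtain ⟨t, ht, htc, hle⟩ := ih h2 hsub hk
      refine ⟨t, ht, by omega, hsf.trans ?_⟩
      rw [Nat.cast_add, Nat.cast_one, ← add_assoc]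
      exact add_le_add_left hle 1
    · have hEne : E.Nonempty := Finset.card_pos.1 (by omega)
      refine ⟨s.image f, (hEne.mono hEs).image f, ?_, hsf.trans ?_⟩
      · refine lt_of_le_of_ne hcard fun heq => h2 ?_
        have hinj := Finset.card_image_iff.1 heq
        rw [Finset.card_image_of_injOn (hinj.mono (by exact_mod_cast hEs))]
        exact hE
      · gcongr
        push_cast
        exact le_add_self

/-- The largest finite distance of a pair. -/
theorem exists_max_pair {s : Finset Q} (hs : s.card = 2) (hlive : d s ≠ ⊤) :
    ∃ p : ℕ, (∃ t : Finset Q, t.card = 2 ∧ d t = p) ∧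
      ∀ t : Finset Q, t.card = 2 → d t ≠ ⊤ → d t ≤ p := by
  obtain ⟨t, ht, hmax⟩ := Finset.exists_max_image
    ((Finset.powersetCard 2 Finset.univ).filter fun t : Finset Q => d t ≠ ⊤)
    (fun t : Finset Q => d t) ⟨s, by simpa [Finset.mem_powersetCard] using ⟨hs, hlive⟩⟩
  simp only [Finset.mem_filter, Finset.mem_powersetCard, Finset.subset_univ, true_and] at ht hmax
  obtain ⟨p, hp⟩ := ENat.ne_top_iff_exists.1 ht.2
  exact ⟨p, ⟨t, ht.1, hp.symm⟩, fun u hu hul => (hmax u ⟨hu, hul⟩).trans hp.symm.le⟩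

section NoDead

variable {p : ℕ} (hp : ∀ t : Finset Q, t.card = 2 → d t ≤ p)

include hp

theorem le_of_card_le_two {s : Finset Q} (hs : s.Nonempty) (h : s.card ≤ 2) : d s ≤ p := by
  have := hs.card_pos
  rcases (by omega : s.card = 1 ∨ s.card = 2) with h1 | h1
  · rw [hd.eq_zero h1]; exact zero_le
  · exact hp s h1

theorem triple_le_add {s E : Finset Q} (h : s.card = 3) (hE : E.card = 2) (hEs : E ⊆ s) :
    d s ≤ d E + p := by
  obtain ⟨k, hk⟩ := ENat.ne_top_iff_exists.1 (ne_top_of_le_ne_top (ENat.natCast_ne_top p) (hp E hE))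
  obtain ⟨t, ht, htc, hle⟩ := hd.compress hE.ge hEs hk.symm
  rw [← hk, add_comm]
  exact hle.trans (add_le_add_left (hd.le_of_card_le_two hp ht (by omega)) _)

theorem triple_le {s : Finset Q} (hs : s.Nonempty) (h : s.card ≤ 3) : d s ≤ (2 * p : ℕ) := by
  by_cases h2 : s.card ≤ 2
  · exact (hd.le_of_card_le_two hp hs h2).trans (by exact_mod_cast (by omega : p ≤ 2 * p))
  · obtain ⟨E, hEs, hE⟩ := Finset.exists_subset_card_eq (show 2 ≤ s.card by omega)
    refine (hd.triple_le_add hp (by omega) hE hEs).trans ?_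
    rw [two_mul]
    push_cast
    exact add_le_add_left (hp E hE) _

theorem quad_le_add {s E : Finset Q} {B : ℕ} (hB : ∀ t : Finset Q, t.Nonempty → t.card ≤ 3 → d t ≤ B)
    (h : s.card = 4) (hE : E.card = 2) (hEs : E ⊆ s) : d s ≤ d E + B := by
  obtain ⟨k, hk⟩ := ENat.ne_top_iff_exists.1 (ne_top_of_le_ne_top (ENat.natCast_ne_top p) (hp E hE))
  obtain ⟨t, ht, htc, hle⟩ := hd.compress hE.ge hEs hk.symm
  rw [← hk, add_comm]
  exact hle.trans (add_le_add_left (hB t ht (by omega)) _)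

end NoDead

end IsDist

end Theory

/-! ### Labellings of the states that satisfy the symmetry breaking. -/

theorem foldr_count_filter (i : ℕ) (q : List ℕ → Bool) (l : List (List ℕ)) :
    (l.filter q).foldr (fun y s => bif y.any (fun x => Nat.beq x i) then s + 1 else s) 0 =
      (l.map fun y => if q y = true ∧ i ∈ y then 1 else 0).sum := by
  induction l with
  | nil => rfl
  | cons y l ih =>
    have h1 : y.any (fun x => Nat.beq x i) = decide (i ∈ y) := by
      rw [Bool.eq_iff_iff, List.any_eq_true, decide_eq_true_eq]
      simp
    rw [List.map_cons, List.sum_cons, ← ih, List.filter_cons]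
    cases hq : q y
    · simp
    · by_cases hi : i ∈ y
      · simp [h1, hi, add_comm]
      · simp [h1, hi]

section Labelling

variable {Q : Type u} [Fintype Q] [DecidableEq Q] {F : Set (Q → Q)} {d : Set Q → ℕ∞}

open Classical in
/-- The number of points at pair distance `j` from `q`. -/
noncomputable def degree (d : Set Q → ℕ∞) (j : ℕ) (q : Q) : ℕ :=
  (Finset.univ.filter fun q' : Q => q' ≠ q ∧ d {q, q'} = j).card

/-- The label-free form of the key of the search. -/
noncomputable def rank (d : Set Q → ℕ∞) (T : Finset Q) : ℕ → Q → ℕ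
  | 0, q => if q ∈ T then 1 else 0
  | j + 1, q => 16 * rank d T j q + degree d (j + 1) q

theorem exists_antitone {n : ℕ} (hcard : Fintype.card Q = n) (g : Q → ℕ) :
    ∃ e : Q ≃ Fin n, Antitone fun i => g (e.symm i) := by
  let e := Fintype.equivFinOfCardEq hcard
  let f : Fin n → ℕᵒᵈ := fun i => OrderDual.toDual (g (e.symm i))
  exact ⟨e.trans (Tuple.sort f).symm, fun i j hij => Tuple.monotone_sort f hij⟩

/-- Degrees are below 16, so ranks are ordered lexicographically by their history: sorting by the
last rank sorts by all earlier ones. -/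
theorem rank_antitone {n : ℕ} (hn : n ≤ 5) (e : Q ≃ Fin n) (T : Finset Q) {p : ℕ}
    (h : Antitone fun i => rank d T p (e.symm i)) {j : ℕ} (hj : j ≤ p) :
    Antitone fun i => rank d T j (e.symm i) := by
  induction hj using Nat.decreasingInduction with
  | self => exact h
  | of_succ k hk ih =>
    intro a b hab
    have hlt : ∀ q, degree d (k + 1) q < 16 := by
      intro q
      have h1 : Fintype.card Q = n := by simpa using Fintype.card_congr e
      have h2 := Finset.card_le_univ (Finset.univ.filter fun q' : Q => q' ≠ q ∧ d {q, q'} = (k + 1 : ℕ))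
      unfold degree
      exact lt_of_le_of_lt (by convert h2) (by omega)
    have h1 := ih hab
    have h2 := hlt (e.symm a)
    have h3 := hlt (e.symm b)
    simp only [rank] at h1 ⊢
    omega

theorem pts_pair {n : ℕ} (e : Q ≃ Fin n) (a b : Fin n) :
    pts e [(a : ℕ), (b : ℕ)] = {e.symm a, e.symm b} := by
  ext q
  simp [pts, Fin.val_inj, Equiv.eq_symm_apply]

theorem pts_single {n : ℕ} (e : Q ≃ Fin n) (a : Fin n) : pts e [(a : ℕ)] = {e.symm a} := by
  ext q
  simp [pts, Fin.val_inj, Equiv.eq_symm_apply]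

/-- The lists of singletons and pairs of the points `0, …, n - 1`. -/
structure Listing (n : ℕ) (pairs singles : List (List ℕ)) : Prop where
  le_five : n ≤ 5
  single : ∀ y ∈ singles, ∃ a : Fin n, y = [(a : ℕ)]
  mem_single : ∀ a : Fin n, [(a : ℕ)] ∈ singles
  pair : ∀ y ∈ pairs, ∃ a b : Fin n, a ≠ b ∧ y = [(a : ℕ), (b : ℕ)]
  mem_pair : ∀ a b : Fin n, a < b → [(a : ℕ), (b : ℕ)] ∈ pairs
  degree_eq : ∀ (Q : Type u) [Fintype Q] [DecidableEq Q] (e : Q ≃ Fin n) (d : Set Q → ℕ∞) (j : ℕ)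
    (i : Fin n), (level e d pairs singles (j + 1)).foldr
      (fun y s => bif y.any (fun x => Nat.beq x i) then s + 1 else s) 0 = degree d (j + 1) (e.symm i)

def pairs4 : List (List ℕ) := [[0, 1], [0, 2], [0, 3], [1, 2], [1, 3], [2, 3]]

def singles4 : List (List ℕ) := [[0], [1], [2], [3]]

theorem listing5 : Listing.{u} 5 pairs5 singles5 where
  le_five := le_rfl
  single := by decide
  mem_single := by decide
  pair := by decide
  mem_pair := by decide
  degree_eq := by
    intro Q _ _ e d j i
    classical
    have hp := pts_pair (n := 5) e
    rw [level, if_neg (Nat.succ_ne_zero j), foldr_count_filter]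
    unfold degree
    rw [Finset.card_filter, ← Equiv.sum_comp e.symm, Fin.sum_univ_five]
    have h01 := hp 0 1
    have h02 := hp 0 2
    have h03 := hp 0 3
    have h04 := hp 0 4
    have h12 := hp 1 2
    have h13 := hp 1 3
    have h14 := hp 1 4
    have h23 := hp 2 3
    have h24 := hp 2 4
    have h34 := hp 3 4
    simp only [Fin.isValue, Fin.val_zero, Fin.val_one, Fin.val_two,
      show ((3 : Fin 5) : ℕ) = 3 from rfl, show ((4 : Fin 5) : ℕ) = 4 from rfl] at *
    simp only [pairs5, List.map_cons, List.map_nil, List.sum_cons, List.sum_nil, h01, h02, h03, h04,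
      h12, h13, h14, h23, h24, h34]
    have hc : ∀ a b : Fin 5, ({e.symm a, e.symm b} : Set Q) = {e.symm b, e.symm a} :=
      fun a b => Set.pair_comm _ _
    fin_cases i <;>
      simp [hc 1 0, hc 2 0, hc 3 0, hc 4 0, hc 2 1, hc 3 1, hc 4 1, hc 3 2, hc 4 2, hc 4 3,
        add_assoc]

theorem listing4 : Listing.{u} 4 pairs4 singles4 where
  le_five := by norm_num
  single := by decide
  mem_single := by decide
  pair := by decide
  mem_pair := by decide
  degree_eq := by
    intro Q _ _ e d j i
    classical
    have hp := pts_pair (n := 4) e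
    rw [level, if_neg (Nat.succ_ne_zero j), foldr_count_filter]
    unfold degree
    rw [Finset.card_filter, ← Equiv.sum_comp e.symm, Fin.sum_univ_four]
    have h01 := hp 0 1
    have h02 := hp 0 2
    have h03 := hp 0 3
    have h12 := hp 1 2
    have h13 := hp 1 3
    have h23 := hp 2 3
    simp only [Fin.isValue, Fin.val_zero, Fin.val_one, Fin.val_two,
      show ((3 : Fin 4) : ℕ) = 3 from rfl] at *
    simp only [pairs4, List.map_cons, List.map_nil, List.sum_cons, List.sum_nil, h01, h02, h03,
      h12, h13, h23]
    have hc : ∀ a b : Fin 4, ({e.symm a, e.symm b} : Set Q) = {e.symm b, e.symm a} :=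
      fun a b => Set.pair_comm _ _
    fin_cases i <;> simp [hc 1 0, hc 2 0, hc 3 0, hc 2 1, hc 3 1, hc 3 2, add_assoc]

theorem refineKey_ofFn (v : List (List ℕ)) {m : ℕ} (s : ℕ) (g : Fin m → ℕ) :
    refineKey v s (List.ofFn g) = List.ofFn fun i : Fin m => 16 * g i +
      v.foldr (fun y t => bif y.any (fun x => Nat.beq x (s + i)) then t + 1 else t) 0 := by
  induction m generalizing s with
  | zero => simp [refineKey]
  | succ m ih =>
    rw [List.ofFn_succ, refineKey, ih, List.ofFn_succ]
    simp only [Fin.val_zero, add_zero, Fin.val_succ]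
    congr 3
    funext i
    rw [show s + 1 + (i : ℕ) = s + ((i : ℕ) + 1) by omega]

theorem antitoneB_ofFn {m : ℕ} (g : Fin m → ℕ) (hg : Antitone g) :
    antitoneB (List.ofFn g) = true := by
  induction m with
  | zero => simp [antitoneB]
  | succ m ih =>
    rw [List.ofFn_succ]
    unfold antitoneB
    rw [ih _ fun a b hab => hg (Fin.succ_le_succ_iff.2 hab), Bool.and_true]
    cases m with
    | zero => simp
    | succ m =>
      rw [List.ofFn_succ]
      exact Nat.ble_eq_true_of_le (hg (Fin.zero_le _))

/-- A labelling compatible with the key of the search. -/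
theorem exists_labelling {n : ℕ} {pairs singles : List (List ℕ)} (hL : Listing.{u} n pairs singles)
    (hcard : Fintype.card Q = n) (d : Set Q → ℕ∞) (T : Finset Q) (p : ℕ) :
    ∃ e : Q ≃ Fin n, pts e (List.range T.card) = T ∧ ∀ j ≤ p, antitoneB (keyAt e d pairs singles
      (List.ofFn fun i : Fin n => if (i : ℕ) < T.card then 1 else 0) j) = true := by
  obtain ⟨e, he⟩ := exists_antitone hcard (rank d T p)
  -- The rank at stage 0 is the indicator of `T`, so sorting turns `T` into an initial segment.
  have hT : ∀ i : Fin n, e.symm i ∈ T ↔ (i : ℕ) < T.card := by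
    have h0 := rank_antitone hL.le_five e T he (Nat.zero_le p)
    have hlow : ∀ i j : Fin n, i ≤ j → e.symm j ∈ T → e.symm i ∈ T := by
      intro i j hij hj
      by_contra hi
      have := h0 hij
      simp [rank, hi, hj] at this
    have hmap : (T.map e.toEmbedding).card = T.card := Finset.card_map _
    intro i
    constructor
    · intro hi
      have : Finset.Iic i ⊆ T.map e.toEmbedding := by
        intro j hj
        rw [Finset.mem_map_equiv]
        exact hlow j i (Finset.mem_Iic.1 hj) hi
      have := Finset.card_le_card this
      rw [Fin.card_Iic, hmap] at this
      omega
    · intro hi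
      by_contra hni
      have : T.map e.toEmbedding ⊆ Finset.Iio i := by
        intro j hj
        rw [Finset.mem_map_equiv] at hj
        rw [Finset.mem_Iio]
        by_contra hij
        exact hni (hlow i j (not_lt.1 hij) hj)
      have := Finset.card_le_card this
      rw [Fin.card_Iio, hmap] at this
      omega
  refine ⟨e, ?_, ?_⟩
  · ext q
    have := hT (e q)
    simp only [Equiv.symm_apply_apply] at this
    simp [pts, this]
  · have hkey : ∀ j, keyAt e d pairs singles
        (List.ofFn fun i : Fin n => if (i : ℕ) < T.card then 1 else 0) j =
        List.ofFn fun i => rank d T j (e.symm i) := by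
      intro j
      induction j with
      | zero => simp [keyAt, rank, hT]
      | succ j ih =>
        rw [keyAt, ih, refineKey_ofFn]
        congr 1
        funext i
        rw [zero_add, hL.degree_eq Q e d j i]
        rfl
    intro j hj
    rw [hkey]
    exact antitoneB_ofFn _ (rank_antitone hL.le_five e T he hj)

/-- The search from its initial state. -/
def start (n : ℕ) (pairs singles : List (List ℕ)) (P : Params) (p : ℕ) (key : List ℕ) : Bool :=
  search P p 0 (intoMask (List.range n) (List.range n)) [singles] singles pairs [] key

theorem Listing.exists_list {n : ℕ} {pairs singles : List (List ℕ)} (hL : Listing.{u} n pairs singles)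
    (e : Q ≃ Fin n) {s : Finset Q} (hs : s.card = 2) : ∃ y ∈ pairs, pts e y = s := by
  obtain ⟨a, b, hab, rfl⟩ := Finset.card_eq_two.1 hs
  rcases lt_or_gt_of_ne (fun h => hab (e.injective h) : e a ≠ e b) with h | h
  · exact ⟨_, hL.mem_pair _ _ h, by rw [pts_pair]; simp⟩
  · exact ⟨_, hL.mem_pair _ _ h, by rw [pts_pair]; simp [Set.pair_comm]⟩

theorem Listing.exists_finset {n : ℕ} {pairs singles : List (List ℕ)}
    (hL : Listing.{u} n pairs singles) (e : Q ≃ Fin n) {y : List ℕ} (hy : y ∈ pairs) :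
    ∃ s : Finset Q, s.card = 2 ∧ pts e y = s := by
  obtain ⟨a, b, hab, rfl⟩ := hL.pair y hy
  exact ⟨{e.symm a, e.symm b}, Finset.card_pair (e.symm.injective.ne hab), by
    rw [pts_pair]; simp⟩

theorem start_false {n : ℕ} {pairs singles : List (List ℕ)} (hL : Listing.{u} n pairs singles)
    (hcard : Fintype.card Q = n) (hd : IsDist F d) {P : Params} {p : ℕ} (T : Finset Q)
    (hT : T.Nonempty) (hZ : P.Z = List.range T.card)
    (hbig : ∀ y ∈ P.big, y ≠ [] ∧ ∀ x ∈ y, x < n) (hlb : (P.lb : ℕ∞) ≤ d T)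
    (hml : ∀ E : Finset Q, E ⊆ T → E.card = 2 → (P.ml : ℕ∞) ≤ d E)
    (hfull : P.full = true → ∀ E : Finset Q, E.card = 2 → d E ≠ ⊤)
    (hp : ∃ E : Finset Q, E.card = 2 ∧ d E = p)
    (hmax : ∀ E : Finset Q, E.card = 2 → d E ≠ ⊤ → d E ≤ p)
    (hdead : P.dead ≤
      ((Finset.powersetCard 2 Finset.univ).filter fun E : Finset Q => d E = ⊤).card) :
    start n pairs singles P p
      (List.ofFn fun i : Fin n => if (i : ℕ) < T.card then 1 else 0) = false := by
  obtain ⟨e, heT, hanti⟩ := exists_labelling hL hcard d T p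
  have hTn : T.card ≤ n := hcard ▸ Finset.card_le_univ T
  have hM : Matches e d pairs singles F P p
      (List.ofFn fun i : Fin n => if (i : ℕ) < T.card then 1 else 0) :=
    { isDist := hd
      le_five := hL.le_five
      singles_lt := by
        intro y hy
        obtain ⟨a, rfl⟩ := hL.single y hy
        simp
      singles_dist := by
        intro y hy
        obtain ⟨a, rfl⟩ := hL.single y hy
        rw [pts_single]
        exact hd.singleton _
      pairs_lt := by
        intro y hy
        obtain ⟨a, b, -, rfl⟩ := hL.pair y hy
        simp
      Z_lt := by
        rw [hZ]
        refine ⟨by simpa [List.range_eq_nil] using hT.ne_empty, fun x hx => ?_⟩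
        rw [List.mem_range] at hx
        omega
      big_lt := hbig
      lb_le := by rwa [hZ, heT]
      ml_le := by
        intro y hy hs
        obtain ⟨s, hs2, hys⟩ := hL.exists_finset e hy
        rw [hys]
        refine hml s ?_ hs2
        have := pts_mono (e := e) hs
        rw [hys, hZ, heT] at this
        exact_mod_cast this
      full := by
        intro hf y hy
        obtain ⟨s, hs2, hys⟩ := hL.exists_finset e hy
        rw [hys]
        exact hfull hf s hs2
      le_top := by
        intro y hy hlt
        obtain ⟨s, hs2, hys⟩ := hL.exists_finset e hy
        rw [hys] at hlt ⊢
        by_contra hne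
        exact absurd hlt (not_lt.2 (hmax s hs2 hne))
      exists_level := by
        intro j h1 hj
        obtain ⟨E, hE, hEp⟩ := hp
        obtain ⟨t, ht, htj⟩ := hd.exists_dist_eq hd.exists_pair (s := E)
          (by simpa [Finset.mem_powersetCard] using hE) hEp j h1 hj
        obtain ⟨y, hy, hyt⟩ := hL.exists_list e (s := t)
          (by simpa [Finset.mem_powersetCard] using ht)
        exact ⟨y, hy, by rw [hyt, htj]⟩
      dead_le := by
        classical
        refine hdead.trans (le_trans ?_ (List.toFinset_card_le _))
        refine le_trans (Finset.card_le_card (t := (above e d pairs p).toFinset.image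
          fun y => (pts e y).toFinset) ?_) Finset.card_image_le
        intro E hE
        simp only [Finset.mem_filter, Finset.mem_powersetCard, Finset.subset_univ, true_and] at hE
        obtain ⟨y, hy, hyE⟩ := hL.exists_list e hE.1
        refine Finset.mem_image.2 ⟨y, ?_, ?_⟩
        · rw [List.mem_toFinset, mem_above, hyE, hE.2]
          exact ⟨hy, ENat.natCast_lt_top _⟩
        · ext q; simp [hyE]
      pair_step := by
        intro y hy j hj
        obtain ⟨s, hs2, hys⟩ := hL.exists_finset e hy
        rw [hys] at hj ⊢
        obtain ⟨f, hf, hk⟩ := hd.exists_image s j hj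
        refine ⟨f, hf, ?_⟩
        have hmt : ∀ w, pts e w = (s.image f : Finset Q) →
            Set.MapsTo f (s : Set Q) (pts e w) := by
          intro w hw q hq
          rw [hw]
          exact_mod_cast Finset.mem_image_of_mem f hq
        cases j with
        | zero =>
          obtain ⟨q, hq⟩ := hd.eq_singleton _ hk
          refine ⟨[((e q : Fin n) : ℕ)], by simpa [level] using hL.mem_single _, hmt _ ?_⟩
          rw [pts_single, hq]
          simp
        | succ j =>
          have h2 := hd.two_le_card (hd.nonempty _ _ hk) (by
            rw [hk]; exact_mod_cast Nat.succ_ne_zero j)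
          have h3 := Finset.card_image_le (s := s) (f := f)
          obtain ⟨w, hw, hws⟩ := hL.exists_list e (s := s.image f) (by omega)
          refine ⟨w, ?_, hmt w hws⟩
          rw [level, if_neg (Nat.succ_ne_zero j)]
          exact List.mem_filter.2 ⟨hw, by rw [hws]; simpa using hk⟩
      key_anti := hanti }
  have hab : above e d pairs 0 = pairs := by
    unfold above
    rw [List.filter_eq_self]
    intro y hy
    obtain ⟨s, hs2, hys⟩ := hL.exists_finset e hy
    rw [hys]
    simpa [pos_iff_ne_zero] using hd.ne_zero hs2.ge
  have := hM.search_false p 0 (intoMask (List.range n) (List.range n)) [] (by omega)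
    (fun f _ => by
      rw [testBit_intoMask e hL.le_five f (by simp) (by simp)]
      intro q _
      simp [pts])
    (by simp)
  rw [hab] at this
  exact this

end Labelling

/-! ### Runs of the search. -/

def big4 : List (List ℕ) := [[0, 1, 2], [0, 1, 3], [0, 2, 3], [1, 2, 3]]

/-- A triple at distance at least 14 has all its pairs at distance at least `14 - p`, by
`triple_le_add`. -/
theorem start_triple5_7 : start 5 pairs5 singles5 ⟨[0, 1, 2], 14, 7, 0, true, big5⟩ 7
    [1, 1, 1, 0, 0] = true := by decide +kernel

theorem start_triple5_8 : start 5 pairs5 singles5 ⟨[0, 1, 2], 14, 6, 0, true, big5⟩ 8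
    [1, 1, 1, 0, 0] = true := by decide +kernel

theorem start_triple5_9 : start 5 pairs5 singles5 ⟨[0, 1, 2], 14, 5, 0, true, big5⟩ 9
    [1, 1, 1, 0, 0] = true := by decide +kernel

theorem start_triple5_10 : start 5 pairs5 singles5 ⟨[0, 1, 2], 14, 4, 0, true, big5⟩ 10
    [1, 1, 1, 0, 0] = true := by decide +kernel

/-- The bound for the pairs is `16 - min 13 (2 * p)`, from `quad_le_add`. -/
theorem start_quad5_6 : start 5 pairs5 singles5 ⟨[0, 1, 2, 3], 16, 4, 0, true, big5⟩ 6
    [1, 1, 1, 1, 0] = true := by decide +kernel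

theorem start_quad5_7 : start 5 pairs5 singles5 ⟨[0, 1, 2, 3], 16, 3, 0, true, big5⟩ 7
    [1, 1, 1, 1, 0] = true := by decide +kernel

theorem start_quad5_8 : start 5 pairs5 singles5 ⟨[0, 1, 2, 3], 16, 3, 0, true, big5⟩ 8
    [1, 1, 1, 1, 0] = true := by decide +kernel

theorem start_quad5_9 : start 5 pairs5 singles5 ⟨[0, 1, 2, 3], 16, 3, 0, true, big5⟩ 9
    [1, 1, 1, 1, 0] = true := by decide +kernel

theorem start_quad5_10 : start 5 pairs5 singles5 ⟨[0, 1, 2, 3], 16, 3, 0, true, big5⟩ 10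
    [1, 1, 1, 1, 0] = true := by decide +kernel

theorem start_triple4_5 : start 4 pairs4 singles4 ⟨[0, 1, 2], 9, 4, 0, true, big4⟩ 5
    [1, 1, 1, 0] = true := by decide +kernel

theorem start_triple4_6 : start 4 pairs4 singles4 ⟨[0, 1, 2], 9, 3, 0, true, big4⟩ 6
    [1, 1, 1, 0] = true := by decide +kernel

/-- The case left over in `triple_le_of_two_dead`: at least two dead pairs and no bound on the pairs
in the triple. -/
theorem start_dead5_8 : start 5 pairs5 singles5 ⟨[0, 1, 2], 13, 0, 2, false, big5⟩ 8
    [1, 1, 1, 0, 0] = true := by decide +kernel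

/-! ### Upper bounds when all pairs are live. -/

section Bounds

variable {Q : Type u} [Fintype Q] [DecidableEq Q] {F : Set (Q → Q)} {d : Set Q → ℕ∞}

namespace IsDist

variable (hd : IsDist F d)

include hd

/-- The distance of a pair is at most the number of pairs. -/
theorem pair_le_choose {s : Finset Q} (hs : s.card = 2) {N : ℕ} (hN : d s = N) :
    N ≤ (Fintype.card Q).choose 2 := by
  refine (hd.pair_le hs hN).trans ((Finset.card_filter_le _ _).trans ?_)
  rw [Finset.card_powersetCard, Finset.card_univ]

theorem exists_max {T : Finset Q} (hT : 2 ≤ T.card) (hlive : ∀ E : Finset Q, E.card = 2 → d E ≠ ⊤) :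
    ∃ p : ℕ, p ≤ (Fintype.card Q).choose 2 ∧ (∃ E : Finset Q, E.card = 2 ∧ d E = p) ∧
      ∀ E : Finset Q, E.card = 2 → d E ≤ p := by
  obtain ⟨E, -, hE⟩ := Finset.exists_subset_card_eq hT
  obtain ⟨p, ⟨E', hE', hp⟩, hmax⟩ := hd.exists_max_pair hE (hlive E hE)
  exact ⟨p, hd.pair_le_choose hE' hp, ⟨E', hE', hp⟩, fun t ht => hmax t ht (hlive t ht)⟩

theorem start_false_of_live {n : ℕ} {pairs singles : List (List ℕ)}
    (hL : Listing.{u} n pairs singles) (hcard : Fintype.card Q = n)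
    (hlive : ∀ E : Finset Q, E.card = 2 → d E ≠ ⊤) {Z : List ℕ} {lb ml p : ℕ}
    {big : List (List ℕ)} {T : Finset Q} (hT : 2 ≤ T.card) (hZ : Z = List.range T.card)
    (hbig : ∀ y ∈ big, y ≠ [] ∧ ∀ x ∈ y, x < n) (hlb : (lb : ℕ∞) ≤ d T)
    (hml : ∀ E : Finset Q, E ⊆ T → E.card = 2 → (ml : ℕ∞) ≤ d E)
    (hp : ∃ E : Finset Q, E.card = 2 ∧ d E = p) (hmax : ∀ E : Finset Q, E.card = 2 → d E ≤ p) :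
    start n pairs singles ⟨Z, lb, ml, 0, true, big⟩ p
      (List.ofFn fun i : Fin n => if (i : ℕ) < T.card then 1 else 0) = false :=
  start_false hL hcard hd T (Finset.card_pos.1 (by omega)) hZ hbig hlb hml (fun _ => hlive) hp
    (fun E hE _ => hmax E hE) (Nat.zero_le _)

theorem triple5_le (hcard : Fintype.card Q = 5) (hlive : ∀ E : Finset Q, E.card = 2 → d E ≠ ⊤)
    {T : Finset Q} (hT : T.card = 3) : d T ≤ (13 : ℕ) := by
  by_contra hlt
  have hlb : ((14 : ℕ) : ℕ∞) ≤ d T := Order.add_one_le_of_lt (not_le.1 hlt)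
  obtain ⟨p, hp10, hp, hmax⟩ := hd.exists_max (by omega : 2 ≤ T.card) hlive
  rw [hcard] at hp10
  replace hp10 : p ≤ 10 := hp10
  have hp7 : 7 ≤ p := by
    have := hlb.trans (hd.triple_le hmax (Finset.card_pos.1 (by omega)) hT.le)
    have : 14 ≤ 2 * p := by exact_mod_cast this
    omega
  have hml : ∀ E : Finset Q, E ⊆ T → E.card = 2 → ((14 - p : ℕ) : ℕ∞) ≤ d E := by
    intro E hE hE2
    have := hlb.trans (hd.triple_le_add hmax hT hE2 hE)
    rw [ENat.natCast_sub]
    exact tsub_le_iff_right.2 this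
  have := hd.start_false_of_live listing5 hcard hlive (by omega : 2 ≤ T.card)
    (Z := [0, 1, 2]) (big := big5) (by rw [hT]; rfl) (by decide) hlb hml hp hmax
  rw [hT] at this
  interval_cases p
  · exact absurd (start_triple5_7.symm.trans this) (by decide)
  · exact absurd (start_triple5_8.symm.trans this) (by decide)
  · exact absurd (start_triple5_9.symm.trans this) (by decide)
  · exact absurd (start_triple5_10.symm.trans this) (by decide)

theorem triple4_le (hcard : Fintype.card Q = 4) (hlive : ∀ E : Finset Q, E.card = 2 → d E ≠ ⊤)
    {T : Finset Q} (hT : T.card = 3) : d T ≤ (8 : ℕ) := by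
  by_contra hlt
  have hlb : ((9 : ℕ) : ℕ∞) ≤ d T := Order.add_one_le_of_lt (not_le.1 hlt)
  obtain ⟨p, hp6, hp, hmax⟩ := hd.exists_max (by omega : 2 ≤ T.card) hlive
  rw [hcard] at hp6
  replace hp6 : p ≤ 6 := hp6
  have hp5 : 5 ≤ p := by
    have := hlb.trans (hd.triple_le hmax (Finset.card_pos.1 (by omega)) hT.le)
    have : 9 ≤ 2 * p := by exact_mod_cast this
    omega
  have hml : ∀ E : Finset Q, E ⊆ T → E.card = 2 → ((9 - p : ℕ) : ℕ∞) ≤ d E := by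
    intro E hE hE2
    have := hlb.trans (hd.triple_le_add hmax hT hE2 hE)
    rw [ENat.natCast_sub]
    exact tsub_le_iff_right.2 this
  have := hd.start_false_of_live listing4 hcard hlive (by omega : 2 ≤ T.card)
    (Z := [0, 1, 2]) (big := big4) (by rw [hT]; rfl) (by decide) hlb hml hp hmax
  rw [hT] at this
  interval_cases p
  · exact absurd (start_triple4_5.symm.trans this) (by decide)
  · exact absurd (start_triple4_6.symm.trans this) (by decide)

theorem quad5_le (hcard : Fintype.card Q = 5) (hlive : ∀ E : Finset Q, E.card = 2 → d E ≠ ⊤)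
    {T : Finset Q} (hT : T.card = 4) : d T ≤ (15 : ℕ) := by
  by_contra hlt
  have hlb : ((16 : ℕ) : ℕ∞) ≤ d T := Order.add_one_le_of_lt (not_le.1 hlt)
  obtain ⟨p, hp10, hp, hmax⟩ := hd.exists_max (by omega : 2 ≤ T.card) hlive
  rw [hcard] at hp10
  replace hp10 : p ≤ 10 := hp10
  -- For `p = 6` the bound `2 * p` is better than the 13 of `triple5_le`.
  have hB : ∀ t : Finset Q, t.Nonempty → t.card ≤ 3 → d t ≤ (min 13 (2 * p) : ℕ) := by
    intro t ht htc
    have h1 := hd.triple_le hmax ht htc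
    rcases Nat.lt_or_ge t.card 3 with h3 | h3
    · refine (hd.le_of_card_le_two hmax ht (by omega)).trans ?_
      exact_mod_cast (by omega : p ≤ min 13 (2 * p))
    · have h2 := hd.triple5_le hcard hlive (by omega : t.card = 3)
      rcases le_total 13 (2 * p) with h | h
      · rw [min_eq_left h]; exact h2
      · rw [min_eq_right h]; exact h1
  have hml : ∀ E : Finset Q, E ⊆ T → E.card = 2 →
      ((16 - min 13 (2 * p) : ℕ) : ℕ∞) ≤ d E := by
    intro E hE hE2
    have := hlb.trans (hd.quad_le_add hmax hB hT hE2 hE)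
    rw [ENat.natCast_sub]
    exact tsub_le_iff_right.2 this
  have hp6 : 6 ≤ p := by
    obtain ⟨E, hE, hE2⟩ := Finset.exists_subset_card_eq (show 2 ≤ T.card by omega)
    have h1 := (hml E hE hE2).trans (hmax E hE2)
    have : 16 - min 13 (2 * p) ≤ p := by exact_mod_cast h1
    omega
  have := hd.start_false_of_live listing5 hcard hlive (by omega : 2 ≤ T.card)
    (Z := [0, 1, 2, 3]) (big := big5) (by rw [hT]; rfl) (by decide) hlb hml hp hmax
  rw [hT] at this
  interval_cases p
  · exact absurd (start_quad5_6.symm.trans this) (by decide)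
  · exact absurd (start_quad5_7.symm.trans this) (by decide)
  · exact absurd (start_quad5_8.symm.trans this) (by decide)
  · exact absurd (start_quad5_9.symm.trans this) (by decide)
  · exact absurd (start_quad5_10.symm.trans this) (by decide)

/-- The first letter of a shortest synchronizing word shrinks the set of all states. -/
theorem univ_le {B : ℕ} (hB : ∀ t : Finset Q, t.Nonempty → t.card < Fintype.card Q → d t ≤ B)
    (h : d (Finset.univ : Finset Q) ≠ ⊤) : d (Finset.univ : Finset Q) ≤ (B + 1 : ℕ) := by
  obtain ⟨N, hN⟩ := ENat.ne_top_iff_exists.1 h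
  cases N with
  | zero => rw [← hN]; exact_mod_cast Nat.zero_le _
  | succ N =>
    obtain ⟨f, hf, hk⟩ := hd.exists_image _ N hN.symm
    have hne : (Finset.univ : Finset Q).image f ≠ Finset.univ := by
      intro heq
      rw [heq, ← hN] at hk
      have : N + 1 = N := by exact_mod_cast hk
      omega
    have hlt := Finset.card_lt_univ_of_notMem
      (Classical.not_forall.1 (fun hall => hne (Finset.eq_univ_iff_forall.2 hall))).choose_spec
    have := hB _ (hd.nonempty _ N hk) hlt
    rw [hk] at this
    rw [← hN]
    have : N ≤ B := by exact_mod_cast this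
    exact_mod_cast Nat.succ_le_succ this

/-- If all pairs are live, then so are all nonempty sets. -/
theorem live_of_pairs (hlive : ∀ E : Finset Q, E.card = 2 → d E ≠ ⊤) {s : Finset Q}
    (hs : s.Nonempty) : d s ≠ ⊤ := by
  induction hn : s.card using Nat.strong_induction_on generalizing s with
  | _ n ih =>
    by_cases h1 : s.card = 1
    · rw [hd.eq_zero h1]; exact ENat.zero_ne_top
    · have := hs.card_pos
      obtain ⟨E, hEs, hE⟩ := Finset.exists_subset_card_eq (show 2 ≤ s.card by omega)
      obtain ⟨k, hk⟩ := ENat.ne_top_iff_exists.1 (hlive E hE)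
      obtain ⟨t, ht, htc, hle⟩ := hd.compress hE.ge hEs hk.symm
      have := ih _ (hn ▸ htc) ht rfl
      exact ne_top_of_le_ne_top (by simp [this]) hle

end IsDist

end Bounds

/-! ### Counting in the presence of a dead pair. -/

section Dead

variable {Q : Type u} [Fintype Q] [DecidableEq Q] {F : Set (Q → Q)} {d : Set Q → ℕ∞}

namespace IsDist

variable (hd : IsDist F d)

include hd

/-- A set with an unsynchronizable nonempty subset is unsynchronizable. -/
theorem not_subset {D s : Finset Q} (hD : D.Nonempty) (hDt : d D = ⊤) (hs : d s ≠ ⊤) : ¬ D ⊆ s :=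
  fun h => hs (top_le_iff.1 (hDt ▸ hd.mono' hD h))

theorem pair_add_dead_le {s : Finset Q} (hs : s.card = 2) {N : ℕ} (hN : d s = N) :
    N + ((Finset.powersetCard 2 Finset.univ).filter fun E : Finset Q => d E = ⊤).card ≤
      (Fintype.card Q).choose 2 := by
  have h1 := hd.pair_le hs hN
  have h2 := Finset.card_filter_add_card_filter_not (s := Finset.powersetCard 2 (Finset.univ : Finset Q))
    (fun E : Finset Q => d E = ⊤)
  rw [Finset.card_powersetCard, Finset.card_univ] at h2
  simp only [ne_eq] at h1
  omega

theorem pair_lt_choose {D : Finset Q} (hD : D.card = 2) (hDt : d D = ⊤)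
    {s : Finset Q} (hs : s.card = 2) {N : ℕ} (hN : d s = N) : N < (Fintype.card Q).choose 2 := by
  have h1 := hd.pair_add_dead_le hs hN
  have h2 : 0 < ((Finset.powersetCard 2 Finset.univ).filter fun E : Finset Q => d E = ⊤).card :=
    Finset.card_pos.2 ⟨D, by simp [Finset.mem_powersetCard, hD, hDt]⟩
  omega

/-- At most two of the sets that miss one state avoid a given unsynchronizable pair. -/
theorem le_add_two {D : Finset Q} (hD : D.card = 2) (hDt : d D = ⊤) {B : ℕ}
    (hB : ∀ t : Finset Q, t.card + 2 ≤ Fintype.card Q → ∀ k : ℕ, d t = k → k ≤ B)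
    {s : Finset Q} (hs : s.card + 1 = Fintype.card Q) {N : ℕ} (hN : d s = N) : N ≤ B + 2 := by
  have hDne : D.Nonempty := Finset.card_pos.1 (by omega)
  have key : ∀ t : Finset Q, t.card + 1 = Fintype.card Q → ∀ k : ℕ, d t = k →
      ∃ x ∈ D, t = {x}ᶜ := by
    intro t ht k hk
    have h1 : tᶜ.card = 1 := by rw [Finset.card_compl]; omega
    obtain ⟨x, hx⟩ := Finset.card_eq_one.1 h1
    have ht' : t = {x}ᶜ := by rw [← hx, compl_compl]
    refine ⟨x, ?_, ht'⟩
    obtain ⟨y, hy, hyt⟩ := Finset.not_subset.1 (hd.not_subset hDne hDt (s := t) (by simp [hk]))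
    rw [ht'] at hyt
    have : y = x := by simpa using hyt
    exact this ▸ hy
  -- Otherwise the three distances `N`, `N - 1`, `N - 2` exceed `B` and belong to three different
  -- sets `{x}ᶜ`, with `x` in the two-element set `D`.
  by_contra hlt
  obtain ⟨m, rfl⟩ : ∃ m, N = m + 2 := ⟨N - 2, by omega⟩
  have hstep : ∀ t : Finset Q, t.card + 1 = Fintype.card Q → ∀ k : ℕ, B < k → d t = (k + 1 : ℕ) →
      ∃ t' : Finset Q, t'.card + 1 = Fintype.card Q ∧ d t' = k := by
    intro t ht k hBk hk
    obtain ⟨f, -, hfk⟩ := hd.exists_image t k hk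
    refine ⟨_, ?_, hfk⟩
    have h3 := Finset.card_image_le (s := t) (f := f)
    by_contra hne
    exact absurd (hB _ (by omega) k hfk) (by omega)
  obtain ⟨s1, hs1, h1⟩ := hstep s hs (m + 1) (by omega) hN
  obtain ⟨s2, hs2, h2⟩ := hstep s1 hs1 m (by omega) h1
  obtain ⟨x, hx, rfl⟩ := key s hs _ hN
  obtain ⟨x1, hx1, rfl⟩ := key s1 hs1 _ h1
  obtain ⟨x2, hx2, rfl⟩ := key s2 hs2 _ h2
  have hinj : ∀ {a b : Q} {i j : ℕ}, d (({a}ᶜ : Finset Q) : Set Q) = i →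
      d (({b}ᶜ : Finset Q) : Set Q) = j → i ≠ j → a ≠ b := by
    intro a b i j hi hj hij hab
    rw [hab, hj] at hi
    exact hij (by exact_mod_cast hi.symm)
  have h3 : ({x, x1, x2} : Finset Q).card = 3 := Finset.card_eq_three.2
    ⟨x, x1, x2, hinj hN h1 (by omega), hinj hN h2 (by omega), hinj h1 h2 (by omega), rfl⟩
  have h4 := Finset.card_le_card (show ({x, x1, x2} : Finset Q) ⊆ D by
    simp [Finset.insert_subset_iff, hx, hx1, hx2])
  omega

end IsDist

end Dead

/-! ### Triples among five states with a dead pair. -/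

section Five

variable {F : Set (Fin 5 → Fin 5)} {d : Set (Fin 5) → ℕ∞}

/-- Of the ten triples, three contain `D`, three contain `D'`, and at most one contains both. -/
theorem card_triples_le : ∀ D ∈ Finset.powersetCard 2 (Finset.univ : Finset (Fin 5)),
    ∀ D' ∈ Finset.powersetCard 2 (Finset.univ : Finset (Fin 5)), D ≠ D' →
      ((Finset.powersetCard 3 (Finset.univ : Finset (Fin 5))).filter
        fun t => ¬ D ⊆ t ∧ ¬ D' ⊆ t).card ≤ 5 := by decide +kernel

/-- The pairs and triples that meet `D` in one point. -/
def cross (D : Finset (Fin 5)) : Finset (Finset (Fin 5)) :=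
  Finset.univ.filter fun s => (s.card = 2 ∨ s.card = 3) ∧ (s ∩ D).card = 1

/-- The pairs that meet `D` in one point. -/
def crossPairs (D : Finset (Fin 5)) : Finset (Finset (Fin 5)) :=
  Finset.univ.filter fun s => s.card = 2 ∧ (s ∩ D).card = 1

theorem card_cross : ∀ D ∈ Finset.powersetCard 2 (Finset.univ : Finset (Fin 5)),
    (cross D).card = 12 := by decide +kernel

theorem card_crossPairs : ∀ D ∈ Finset.powersetCard 2 (Finset.univ : Finset (Fin 5)),
    (crossPairs D).card = 6 := by decide +kernel

/-- These are the six pairs and the two triples that contain `V`. -/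
theorem card_cross_filter : ∀ D ∈ Finset.powersetCard 2 (Finset.univ : Finset (Fin 5)),
    ∀ V ∈ crossPairs D, ((cross D).filter fun s => s.card = 3 → V ⊆ s).card = 8 := by
  decide +kernel

theorem mem_cross {D s : Finset (Fin 5)} :
    s ∈ cross D ↔ (s.card = 2 ∨ s.card = 3) ∧ (s ∩ D).card = 1 := by simp [cross]

theorem mem_crossPairs {D s : Finset (Fin 5)} :
    s ∈ crossPairs D ↔ s.card = 2 ∧ (s ∩ D).card = 1 := by simp [crossPairs]

namespace IsDist

variable (hd : IsDist F d)

include hd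

theorem triple_le_of_two_dead {D D' : Finset (Fin 5)} (hD : D.card = 2) (hDt : d D = ⊤)
    (hD' : D'.card = 2) (hDt' : d D' = ⊤) (hne : D ≠ D') {T : Finset (Fin 5)} (hT : T.card = 3)
    {N : ℕ} (hN : d T = N) : N ≤ 12 := by
  by_contra hlt
  have hq : 2 ≤ ((Finset.powersetCard 2 Finset.univ).filter
      fun E : Finset (Fin 5) => d E = ⊤).card := by
    refine Finset.one_lt_card.2 ⟨D, ?_, D', ?_, hne⟩ <;>
      simp [Finset.mem_powersetCard, hD, hDt, hD', hDt']
  have hC : ∀ s ∈ (Finset.univ : Finset (Finset (Fin 5))).filter (fun s => s.card = 2 ∨ s.card = 3),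
      ∀ k : ℕ, 1 ≤ k → d s = (k + 1 : ℕ) →
      ∃ t ∈ (Finset.univ : Finset (Finset (Fin 5))).filter (fun s => s.card = 2 ∨ s.card = 3),
        d t = k := by
    intro s hs k h1 hk
    obtain ⟨f, -, hfk⟩ := hd.exists_image s k hk
    refine ⟨_, ?_, hfk⟩
    simp only [Finset.mem_filter, Finset.mem_univ, true_and] at hs ⊢
    have h2 := hd.two_le_card (hd.nonempty _ k hfk) (by
      rw [hfk]; exact_mod_cast (by omega : k ≠ 0))
    have h3 := Finset.card_image_le (s := s) (f := f)
    omega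
  have hTC : T ∈ (Finset.univ : Finset (Finset (Fin 5))).filter
      (fun s => s.card = 2 ∨ s.card = 3) := by simp [hT]
  obtain ⟨E, hE, hE12⟩ : ∃ E : Finset (Fin 5), E.card = 2 ∧ d E ≠ ⊤ := by
    obtain ⟨E, hET, hE⟩ := Finset.exists_subset_card_eq (show 2 ≤ T.card by omega)
    refine ⟨E, hE, ne_top_of_le_ne_top (by simp [hN]) (hd.mono' (t := T) ?_ hET)⟩
    exact Finset.card_pos.1 (by omega)
  obtain ⟨p, ⟨E', hE', hp⟩, hmax⟩ := hd.exists_max_pair hE hE12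
  have hp8 := hd.pair_add_dead_le hE' hp
  have h10 : (Fintype.card (Fin 5)).choose 2 = 10 := by decide
  have hcard : (Finset.Icc (p + 1) N).card ≤
      ((Finset.powersetCard 3 (Finset.univ : Finset (Fin 5))).filter
        fun t => ¬ D ⊆ t ∧ ¬ D' ⊆ t).card := by
    rw [← Finset.card_image_of_injective (f := fun j : ℕ => (j : ℕ∞)) _ Nat.cast_injective]
    refine (Finset.card_le_card ?_).trans
      (Finset.card_image_le (f := fun t : Finset (Fin 5) => d t))
    intro x hx
    obtain ⟨j, hj, rfl⟩ := Finset.mem_image.1 hx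
    rw [Finset.mem_Icc] at hj
    obtain ⟨t, ht, htj⟩ := hd.exists_dist_eq hC hTC hN j (by omega) hj.2
    simp only [Finset.mem_filter, Finset.mem_univ, true_and] at ht
    have hlive : d t ≠ ⊤ := by simp [htj]
    refine Finset.mem_image.2 ⟨t, ?_, htj⟩
    simp only [Finset.mem_filter, Finset.mem_powersetCard, Finset.subset_univ, true_and]
    refine ⟨ht.resolve_left fun h2 => ?_,
      hd.not_subset (Finset.card_pos.1 (by omega)) hDt hlive,
      hd.not_subset (Finset.card_pos.1 (by omega)) hDt' hlive⟩
    have := hmax t h2 hlive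
    rw [htj] at this
    have : j ≤ p := by exact_mod_cast this
    omega
  have h5 := card_triples_le D (by simp [Finset.mem_powersetCard, hD]) D'
    (by simp [Finset.mem_powersetCard, hD']) hne
  rw [Nat.card_Icc] at hcard
  -- Two dead pairs give `p ≤ 8`, and the distances above `p` belong to at most five triples, so `N
  -- ≥ 13` forces `p = 8`.
  obtain rfl : p = 8 := by omega
  have := start_false listing5 (by simp) hd T (Finset.card_pos.1 (by omega))
    (P := ⟨[0, 1, 2], 13, 0, 2, false, big5⟩) (by rw [hT]; rfl) (by decide)
    (by rw [hN]; exact_mod_cast (by omega : 13 ≤ N)) (fun _ _ _ => zero_le) (by simp)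
    ⟨E', hE', hp⟩ hmax hq
  rw [hT] at this
  exact absurd (start_dead5_8.symm.trans this) (by decide)

section Single

variable {D : Finset (Fin 5)} (hD : D.card = 2) (hDt : d D = ⊤)
  (huniq : ∀ E : Finset (Fin 5), E.card = 2 → d E = ⊤ → E = D)

include hD hDt huniq

/-- The image of a dead set is dead, hence not a singleton, and `D` is the only dead pair. -/
theorem image_dead {f : Fin 5 → Fin 5} (hf : f ∈ F) : D.image f = D := by
  have h1 := hd.le_image D hf
  rw [hDt, top_le_iff] at h1
  have h2 : d (D.image f : Finset (Fin 5)) = ⊤ := by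
    by_contra hne
    obtain ⟨k, hk⟩ := ENat.ne_top_iff_exists.1 hne
    rw [← hk] at h1
    exact absurd h1 (by exact_mod_cast ENat.natCast_ne_top (k + 1))
  refine huniq _ ?_ h2
  have hne : D.Nonempty := Finset.card_pos.1 (by omega)
  have h3 := hd.two_le_card (hne.image f) (by rw [h2]; exact ENat.top_ne_zero)
  have h4 := Finset.card_image_le (s := D) (f := f)
  omega

/-- The image meets `D` because `f` maps `D` to itself, and being live it does not contain `D`. -/
theorem cross_image {s : Finset (Fin 5)} (hs : (s ∩ D).card = 1) {f : Fin 5 → Fin 5}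
    (hf : f ∈ F) (hlive : d (s.image f : Finset (Fin 5)) ≠ ⊤) : (s.image f ∩ D).card = 1 := by
  obtain ⟨a, ha⟩ := Finset.card_eq_one.1 hs
  have haD : a ∈ s ∩ D := by simp [ha]
  rw [Finset.mem_inter] at haD
  have h1 : f a ∈ s.image f ∩ D := Finset.mem_inter.2 ⟨Finset.mem_image_of_mem f haD.1, by
    rw [← hd.image_dead hD hDt huniq hf]; exact Finset.mem_image_of_mem f haD.2⟩
  have h2 := Finset.card_pos.2 ⟨_, h1⟩
  have h3 := Finset.card_le_card (Finset.inter_subset_right (s₁ := s.image f) (s₂ := D))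
  by_contra hne
  have h4 : s.image f ∩ D = D :=
    Finset.eq_of_subset_of_card_le Finset.inter_subset_right (by omega)
  exact hd.not_subset (Finset.card_pos.1 (by omega)) hDt hlive (Finset.inter_eq_right.1 h4)

theorem exists_cross (s : Finset (Fin 5)) (hs : s ∈ cross D) (k : ℕ) (h1 : 1 ≤ k)
    (hk : d s = (k + 1 : ℕ)) : ∃ t ∈ cross D, d t = k := by
  obtain ⟨f, hf, hfk⟩ := hd.exists_image s k hk
  rw [mem_cross] at hs
  refine ⟨_, mem_cross.2 ⟨?_, hd.cross_image hD hDt huniq hs.2 hf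
    (by rw [hfk]; exact ENat.natCast_ne_top k)⟩, hfk⟩
  have h2 := hd.two_le_card (hd.nonempty _ k hfk) (by
    rw [hfk]; exact_mod_cast (by omega : k ≠ 0))
  have h3 := Finset.card_image_le (s := s) (f := f)
  omega

theorem exists_crossPair (s : Finset (Fin 5)) (hs : s ∈ crossPairs D) (k : ℕ) (h1 : 1 ≤ k)
    (hk : d s = (k + 1 : ℕ)) : ∃ t ∈ crossPairs D, d t = k := by
  obtain ⟨f, hf, hfk⟩ := hd.exists_image s k hk
  rw [mem_crossPairs] at hs
  refine ⟨_, mem_crossPairs.2 ⟨?_, hd.cross_image hD hDt huniq hs.2 hf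
    (by rw [hfk]; exact ENat.natCast_ne_top k)⟩, hfk⟩
  have h2 := hd.two_le_card (hd.nonempty _ k hfk) (by
    rw [hfk]; exact_mod_cast (by omega : k ≠ 0))
  have h3 := Finset.card_image_le (s := s) (f := f)
  omega

theorem cross_le {s : Finset (Fin 5)} (hs : s ∈ cross D) {N : ℕ} (hN : d s = N) : N ≤ 12 := by
  have := (hd.le_card_live (hd.exists_cross hD hDt huniq) hs hN).trans (Finset.card_filter_le _ _)
  rwa [card_cross D (by simp [Finset.mem_powersetCard, hD])] at this

theorem crossPair_le {s : Finset (Fin 5)} (hs : s ∈ crossPairs D) {N : ℕ} (hN : d s = N) :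
    N ≤ 6 := by
  have := (hd.le_card_live (hd.exists_crossPair hD hDt huniq) hs hN).trans
    (Finset.card_filter_le _ _)
  rwa [card_crossPairs D (by simp [Finset.mem_powersetCard, hD])] at this

theorem cross_injOn {s : Finset (Fin 5)} (hs : s ∈ cross D) (h12 : d s = (12 : ℕ)) :
    (∀ t ∈ cross D, d t ≠ ⊤) ∧ Set.InjOn (fun t : Finset (Fin 5) => d t) (cross D) := by
  have h1 := hd.le_card_image (hd.exists_cross hD hDt huniq) hs h12
  have h2 := card_cross D (by simp [Finset.mem_powersetCard, hD])
  have h3 : (cross D).filter (fun t : Finset (Fin 5) => d t ≠ ⊤) = cross D :=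
    Finset.eq_of_subset_of_card_le (Finset.filter_subset _ _)
      (h2.le.trans (h1.trans Finset.card_image_le))
  rw [h3] at h1
  refine ⟨fun t ht => (Finset.mem_filter.1 (h3.symm.subset ht)).2, Finset.card_image_iff.1 ?_⟩
  exact le_antisymm Finset.card_image_le (h2.le.trans h1)

/-- Distance 12 would make the distances of the twelve cross sets exactly `1, ..., 12`. Let `f`
merge the cross pair `V` at distance 1. It maps each of the two cross triples containing `V` to a
singleton or a cross pair, so these triples have distance at most 7. With the six cross pairs, at
distance at most 6, eight different values would lie in `1, ..., 7`. -/
theorem cross_lt_twelve {s : Finset (Fin 5)} (hs : s ∈ cross D) : d s ≠ (12 : ℕ) := by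
  intro h12
  obtain ⟨hlive, hinj⟩ := hd.cross_injOn hD hDt huniq hs h12
  have hD' : D ∈ Finset.powersetCard 2 (Finset.univ : Finset (Fin 5)) := by
    simp [Finset.mem_powersetCard, hD]
  have hsub : ∀ {t}, t ∈ crossPairs D → t ∈ cross D := fun h =>
    mem_cross.2 ⟨Or.inl (mem_crossPairs.1 h).1, (mem_crossPairs.1 h).2⟩
  obtain ⟨V, hV, hV1⟩ : ∃ V ∈ crossPairs D, d V = (1 : ℕ) := by
    obtain ⟨P, hP⟩ := Finset.card_pos.1 (by rw [card_crossPairs D hD']; norm_num :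
      0 < (crossPairs D).card)
    obtain ⟨m, hm⟩ := ENat.ne_top_iff_exists.1 (hlive P (hsub hP))
    have hm0 : m ≠ 0 := by
      rintro rfl
      exact hd.ne_zero (mem_crossPairs.1 hP).1.ge hm.symm
    exact hd.exists_dist_eq (hd.exists_crossPair hD hDt huniq) hP hm.symm 1 le_rfl (by omega)
  obtain ⟨f, hf, hf0⟩ := hd.exists_image V 0 hV1
  have hfD := hd.image_dead hD hDt huniq hf
  obtain ⟨q, hq⟩ := hd.eq_singleton _ hf0
  have hVq : ∀ x ∈ V, f x = q := fun x hx => by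
    have : f x ∈ (V.image f : Finset (Fin 5)) := Finset.mem_image_of_mem f hx
    simpa using hq.subset this
  rw [mem_crossPairs] at hV
  obtain ⟨a, ha⟩ := Finset.card_eq_one.1 hV.2
  obtain ⟨haV, haD⟩ : a ∈ V ∧ a ∈ D := Finset.mem_inter.1 (by simp [ha])
  have hqD : q ∈ D := by
    rw [← hVq a haV, ← hfD]; exact Finset.mem_image_of_mem f haD
  have key : ∀ t ∈ cross D, t.card = 3 → V ⊆ t → d t ≤ (7 : ℕ) := by
    intro t ht ht3 hVt
    obtain ⟨i, hi⟩ := Finset.card_eq_one.1 (show (t \ V).card = 1 by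
      rw [Finset.card_sdiff_of_subset hVt]; omega)
    obtain ⟨hit, hiV⟩ : i ∈ t ∧ i ∉ V := Finset.mem_sdiff.1 (by simp [hi])
    have htV : t = insert i V := by
      rw [← Finset.sdiff_union_of_subset hVt, hi, Finset.insert_eq]
    have hiD : i ∉ D := by
      intro hiD
      obtain ⟨b, hb⟩ := Finset.card_eq_one.1 (mem_cross.1 ht).2
      have h1 : i ∈ t ∩ D := Finset.mem_inter.2 ⟨hit, hiD⟩
      have h2 : a ∈ t ∩ D := Finset.mem_inter.2 ⟨hVt haV, haD⟩
      rw [hb, Finset.mem_singleton] at h1 h2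
      exact hiV (h1.trans h2.symm ▸ haV)
    have himg : t.image f = {f i, q} := by
      rw [htV, Finset.image_insert]
      congr 1
      exact_mod_cast hq
    have hle := hd.le_image t hf
    rw [himg] at hle
    by_cases hiq : f i = q
    · rw [hiq, Finset.pair_eq_singleton, hd.eq_zero (Finset.card_singleton q)] at hle
      exact hle.trans (by norm_num)
    -- If `f i ∈ D`, then `f` merges `i` with some `b ∈ D`, and `{i, b}` is a second cross set at
    -- distance 1.
    by_cases hfi : f i ∈ D
    · rw [← hfD] at hfi
      obtain ⟨b, hb, hbi⟩ := Finset.mem_image.1 hfi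
      exfalso
      have hib : i ≠ b := fun h => hiD (h ▸ hb)
      have hE : ({i, b} : Finset (Fin 5)) ∈ cross D := by
        refine mem_cross.2 ⟨Or.inl (Finset.card_pair hib), Finset.card_eq_one.2 ⟨b, ?_⟩⟩
        ext x
        simp only [Finset.mem_inter, Finset.mem_insert, Finset.mem_singleton]
        constructor
        · rintro ⟨rfl | rfl, h⟩
          · exact absurd h hiD
          · rfl
        · rintro rfl; exact ⟨Or.inr rfl, hb⟩
      have h1 := hd.le_image ({i, b} : Finset (Fin 5)) hf
      rw [Finset.image_insert, Finset.image_singleton, hbi, Finset.pair_eq_singleton,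
        hd.eq_zero (Finset.card_singleton (f i)), zero_add] at h1
      have h2 := hd.ne_zero (Finset.card_pair hib).ge
      have h3 : d ({i, b} : Finset (Fin 5)) = (1 : ℕ) :=
        le_antisymm (by simpa using h1) (by simpa [Order.one_le_iff_ne_zero] using h2)
      have := hinj hE (hsub (mem_crossPairs.2 hV)) (h3.trans hV1.symm)
      exact hiV (this ▸ Finset.mem_insert_self i {b})
    · have hE : ({f i, q} : Finset (Fin 5)) ∈ crossPairs D := by
        refine mem_crossPairs.2 ⟨Finset.card_pair hiq, Finset.card_eq_one.2 ⟨q, ?_⟩⟩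
        ext x
        simp only [Finset.mem_inter, Finset.mem_insert, Finset.mem_singleton]
        constructor
        · rintro ⟨rfl | rfl, h⟩
          · exact absurd h hfi
          · rfl
        · rintro rfl; exact ⟨Or.inr rfl, hqD⟩
      obtain ⟨m, hm⟩ := ENat.ne_top_iff_exists.1 (hlive _ (hsub hE))
      have := hd.crossPair_le hD hDt huniq hE hm.symm
      rw [← hm] at hle
      exact hle.trans (by exact_mod_cast (by omega : m + 1 ≤ 7))
  have h8 := card_cross_filter D hD' V (mem_crossPairs.2 hV)
  have himage : ((cross D).filter fun s => s.card = 3 → V ⊆ s).image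
      (fun t : Finset (Fin 5) => d t) ⊆ (Finset.Icc 1 7).image fun j : ℕ => (j : ℕ∞) := by
    intro x hx
    obtain ⟨t, ht, rfl⟩ := Finset.mem_image.1 hx
    obtain ⟨htC, ht3⟩ := Finset.mem_filter.1 ht
    obtain ⟨m, hm⟩ := ENat.ne_top_iff_exists.1 (hlive t htC)
    refine Finset.mem_image.2 ⟨m, Finset.mem_Icc.2 ⟨?_, ?_⟩, hm⟩
    · refine Nat.one_le_iff_ne_zero.2 ?_
      rintro rfl
      exact hd.ne_zero (by have := (mem_cross.1 htC).1; omega) hm.symm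
    · rcases (mem_cross.1 htC).1 with h2 | h3
      · have := hd.crossPair_le hD hDt huniq
          (mem_crossPairs.2 ⟨h2, (mem_cross.1 htC).2⟩) hm.symm
        omega
      · have := key t htC h3 (ht3 h3)
        rw [← hm] at this
        exact_mod_cast this
  have h9 := (Finset.card_le_card himage).trans Finset.card_image_le
  rw [Finset.card_image_of_injOn (hinj.mono fun t ht => (Finset.mem_filter.1 ht).1), h8] at h9
  exact absurd h9 (by decide)

/-- The only live triple outside `cross D` can be `Dᶜ`. Its successor is a pair, at distance at most
9, or a cross triple, at distance at most 11. -/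
theorem triple_le_of_one_dead {T : Finset (Fin 5)} (hT : T.card = 3) {N : ℕ} (hN : d T = N) :
    N ≤ 12 := by
  have hDne : D.Nonempty := Finset.card_pos.1 (by omega)
  have hcompl : ∀ t : Finset (Fin 5), t.card = 3 → d t ≠ ⊤ → t ∉ cross D → t = Dᶜ := by
    intro t ht hlive hC
    have h1 := hd.not_subset hDne hDt hlive
    have h2 : (t ∩ D).card ≠ 1 := fun h => hC (mem_cross.2 ⟨Or.inr ht, h⟩)
    have h3 := Finset.card_le_card (Finset.inter_subset_right (s₁ := t) (s₂ := D))
    have h4 : (t ∩ D).card ≠ 2 := fun h => h1 (Finset.inter_eq_right.1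
      (Finset.eq_of_subset_of_card_le Finset.inter_subset_right (by omega)))
    have h5 : t ∩ D = ∅ := Finset.card_eq_zero.1 (by omega)
    refine Finset.eq_of_subset_of_card_le ?_ (by rw [Finset.card_compl]; simp [hD, ht])
    exact Finset.subset_compl_iff_disjoint_right.2 (Finset.disjoint_iff_inter_eq_empty.2 h5)
  by_contra hlt
  obtain ⟨m, rfl⟩ : ∃ m, N = m + 1 := ⟨N - 1, by omega⟩
  have hTD := hcompl T hT (by rw [hN]; exact ENat.natCast_ne_top _)
    fun h => hlt (hd.cross_le hD hDt huniq h hN)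
  obtain ⟨f, hf, hm⟩ := hd.exists_image T m hN
  have h2 := hd.two_le_card (hd.nonempty _ m hm) (by
    rw [hm]; exact_mod_cast (by omega : m ≠ 0))
  have h3 := Finset.card_image_le (s := T) (f := f)
  by_cases hc : (T.image f).card = 2
  · have := hd.pair_lt_choose hD hDt hc hm
    have h10 : (Fintype.card (Fin 5)).choose 2 = 10 := by decide
    omega
  · by_cases hC : T.image f ∈ cross D
    · have h12 := hd.cross_le hD hDt huniq hC hm
      obtain rfl : m = 12 := by omega
      exact hd.cross_lt_twelve hD hDt huniq hC hm
    · have h4 := hcompl _ (by omega) (by rw [hm]; exact ENat.natCast_ne_top _) hC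
      rw [h4, ← hTD, hN] at hm
      have : m + 1 = m := by exact_mod_cast hm
      omega

end Single

theorem triple_le_of_dead {D : Finset (Fin 5)} (hD : D.card = 2) (hDt : d D = ⊤)
    {T : Finset (Fin 5)} (hT : T.card = 3) {N : ℕ} (hN : d T = N) : N ≤ 12 := by
  by_cases h : ∃ D' : Finset (Fin 5), D'.card = 2 ∧ d D' = ⊤ ∧ D ≠ D'
  · obtain ⟨D', hD', hDt', hne⟩ := h
    exact hd.triple_le_of_two_dead hD hDt hD' hDt' hne hT hN
  · push Not at h
    exact hd.triple_le_of_one_dead hD hDt (fun E hE hEt => (h E hE hEt).symm) hT hN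

end IsDist

end Five

/-! ### Assembling the table. -/

section Table

variable {Q : Type u} [Fintype Q] [DecidableEq Q] {F : Set (Q → Q)} {d : Set Q → ℕ∞}

namespace IsDist

variable (hd : IsDist F d)

/-- Transports the problem to `Fin 5`, where the families of subsets are counted by `decide`. -/
theorem conj {Q : Type*} {R : Type*} {F : Set (Q → Q)} {d : Set Q → ℕ∞} (hd : IsDist F d)
    (e : R ≃ Q) : IsDist ((fun f => e.symm ∘ f ∘ e) '' F) fun S => d (e '' S) := by
  have himg : ∀ (f : Q → Q) (S : Set R), e '' ((e.symm ∘ f ∘ e) '' S) = f '' (e '' S) := by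
    intro f S
    simp [Set.image_image]
  refine ⟨fun q => ?_, fun S h => ?_, fun S T hS hST => ?_, ?_, fun S k h => ?_⟩
  · simpa using hd.singleton (e q)
  · obtain ⟨q, hq⟩ := hd.eq_singleton _ h
    exact ⟨e.symm q, by rw [← Set.image_singleton, ← hq, Equiv.symm_image_image]⟩
  · exact hd.mono _ _ (hS.image e) (Set.image_mono hST)
  · rintro _ S ⟨f, hf, rfl⟩
    simpa only [himg] using hd.step f (e '' S) hf
  · obtain ⟨f, hf, hk⟩ := hd.exists_step _ k h
    exact ⟨_, ⟨f, hf, rfl⟩, by simpa only [himg] using hk⟩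

include hd

theorem triple_le_of_dead' (hcard : Fintype.card Q = 5) {D : Finset Q} (hD : D.card = 2)
    (hDt : d D = ⊤) {T : Finset Q} (hT : T.card = 3) {N : ℕ} (hN : d T = N) : N ≤ 12 := by
  have e : Q ≃ Fin 5 := Fintype.equivFinOfCardEq hcard
  refine (hd.conj e.symm).triple_le_of_dead (D := D.image e) (T := T.image e) (N := N)
    ?_ ?_ ?_ ?_
  · rwa [Finset.card_image_of_injective _ e.injective]
  · simpa using hDt
  · rwa [Finset.card_image_of_injective _ e.injective]
  · simpa using hN

theorem pair_le_pred {D : Finset Q} (hD : D.card = 2) (hDt : d D = ⊤) {s : Finset Q}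
    (hs : s.card ≤ 2) {N : ℕ} (hN : d s = N) : N ≤ (Fintype.card Q).choose 2 - 1 := by
  have h1 := (hd.nonempty s N hN).card_pos
  rcases (by omega : s.card = 1 ∨ s.card = 2) with h | h
  · have h0 := hd.eq_zero h
    rw [hN] at h0
    have : N = 0 := by exact_mod_cast h0
    omega
  · have := hd.pair_lt_choose hD hDt h hN
    omega

/-- The bounds of the table are strict if some pair is unsynchronizable. -/
theorem lt_table {n k : ℕ} (hk : 2 ≤ k) (hkn : k ≤ n) (hn : n ≤ 5) (hcard : Fintype.card Q = n)
    {D : Finset Q} (hD : D.card = 2) (hDt : d D = ⊤) {s : Finset Q} (hs : s.card = k) {N : ℕ}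
    (hN : d s = N) : N < SyncDFA.syncTable n k := by
  have hDne : D.Nonempty := Finset.card_pos.1 (by omega)
  have hlt : k < n := by
    refine lt_of_le_of_ne hkn fun h => hd.not_subset hDne hDt (s := s) ?_ ?_
    · rw [hN]; exact ENat.natCast_ne_top N
    · rw [(Finset.card_eq_iff_eq_univ s).1 (by omega)]
      exact Finset.subset_univ D
  have hpair : ∀ t : Finset Q, t.card ≤ 2 → ∀ m : ℕ, d t = m → m ≤ n.choose 2 - 1 :=
    fun t ht m hm => hcard ▸ hd.pair_le_pred hD hDt ht hm
  have h3 : n = 5 → ∀ t : Finset Q, t.card ≤ 3 → ∀ m : ℕ, d t = m → m ≤ 12 := by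
    rintro rfl t ht m hm
    by_cases h2 : t.card ≤ 2
    · exact (hpair t h2 m hm).trans (by decide)
    · exact hd.triple_le_of_dead' hcard hD hDt (by omega) hm
  interval_cases n <;> interval_cases k
  · exact Nat.lt_succ_of_le (hpair s hs.le N hN)
  · exact Nat.lt_succ_of_le (hpair s hs.le N hN)
  -- With a dead pair, the other pairs of four states have distance at most 5, and `5 + 2 < 8`.
  · exact Nat.lt_succ_of_le (hd.le_add_two hD hDt (B := 5)
      (fun t ht m hm => hpair t (by omega) m hm) (by omega) hN)
  · exact Nat.lt_succ_of_le (hpair s hs.le N hN)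
  · exact Nat.lt_succ_of_le (h3 rfl s hs.le N hN)
  -- Here `12 + 2 < 15`.
  · exact Nat.lt_succ_of_le (hd.le_add_two hD hDt (B := 12)
      (fun t ht m hm => h3 rfl t (by omega) m hm) (by omega) hN)

theorem le_table_of_live {n k : ℕ} (hk : 2 ≤ k) (hkn : k ≤ n) (hn : n ≤ 5)
    (hcard : Fintype.card Q = n) (hlive : ∀ E : Finset Q, E.card = 2 → d E ≠ ⊤) {s : Finset Q}
    (hs : s.card = k) : d s ≤ SyncDFA.syncTable n k := by
  have hpair : ∀ t : Finset Q, t.Nonempty → t.card ≤ 2 → d t ≤ (n.choose 2 : ℕ) :=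
    fun t ht => hd.le_of_card_le_two (fun E hE => by
      obtain ⟨m, hm⟩ := ENat.ne_top_iff_exists.1 (hlive E hE)
      have := hd.pair_le_choose hE hm.symm
      rw [← hm, ← hcard]
      exact_mod_cast this) ht
  have huniv : ∀ B : ℕ, (∀ t : Finset Q, t.Nonempty → t.card < n → d t ≤ B) → k = n →
      d s ≤ (B + 1 : ℕ) := by
    intro B hB hkn
    have hsu := (Finset.card_eq_iff_eq_univ s).1 (by omega)
    subst hcard
    rw [hsu]
    exact hd.univ_le hB (hd.live_of_pairs hlive (hsu ▸ Finset.card_pos.1 (by omega)))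
  have h4 : n = 4 → ∀ t : Finset Q, t.Nonempty → t.card < 4 → d t ≤ (8 : ℕ) := by
    rintro rfl t ht htc
    by_cases h2 : t.card ≤ 2
    · exact (hpair t ht h2).trans (Nat.cast_le.2 (by decide))
    · exact hd.triple4_le hcard hlive (by omega)
  have h5 : n = 5 → ∀ t : Finset Q, t.Nonempty → t.card < 5 → d t ≤ (15 : ℕ) := by
    rintro rfl t ht htc
    by_cases h2 : t.card ≤ 2
    · exact (hpair t ht h2).trans (Nat.cast_le.2 (by decide))
    · rcases (by omega : t.card = 3 ∨ t.card = 4) with h | h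
      · exact (hd.triple5_le hcard hlive h).trans (Nat.cast_le.2 (by decide))
      · exact hd.quad5_le hcard hlive h
  have hsne : s.Nonempty := Finset.card_pos.1 (by omega)
  interval_cases n <;> interval_cases k
  · exact hpair s hsne hs.le
  · exact hpair s hsne hs.le
  · exact huniv 3 (fun t ht htc => hpair t ht (by omega)) rfl
  · exact hpair s hsne hs.le
  · exact hd.triple4_le hcard hlive hs
  · exact huniv 8 (h4 rfl) rfl
  · exact hpair s hsne hs.le
  · exact hd.triple5_le hcard hlive hs
  · exact hd.quad5_le hcard hlive hs
  · exact huniv 15 (h5 rfl) rfl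

theorem le_table {n k : ℕ} (hk : 2 ≤ k) (hkn : k ≤ n) (hn : n ≤ 5) (hcard : Fintype.card Q = n)
    {s : Finset Q} (hs : s.card = k) {N : ℕ} (hN : d s = N) : N ≤ SyncDFA.syncTable n k := by
  by_cases h : ∃ D : Finset Q, D.card = 2 ∧ d D = ⊤
  · obtain ⟨D, hD, hDt⟩ := h
    exact (hd.lt_table hk hkn hn hcard hD hDt hs hN).le
  · push Not at h
    have := hd.le_table_of_live hk hkn hn hcard h hs
    rw [hN] at this
    exact_mod_cast this

end IsDist

end Table

end SyncSearch

namespace SyncDFA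

open SyncSearch

/-! ### The distance function of an automaton. -/

section Distance

variable {Q : Type u} {A : Type v} (M : SyncDFA Q A)

/-- The length of a shortest synchronizing word for `S`, which is `⊤` if there is none. -/
noncomputable def dist (S : Set Q) : ℕ∞ :=
  sInf ((fun l : ℕ => (l : ℕ∞)) '' {l | M.SynchronizesOnIn S l})

variable {M}

theorem SynchronizesOnIn.dist_le {S : Set Q} {l : ℕ} (h : M.SynchronizesOnIn S l) :
    M.dist S ≤ l :=
  sInf_le ⟨l, h, rfl⟩

theorem IsSyncLength.dist_eq {S : Set Q} {l : ℕ} (h : M.IsSyncLength S l) : M.dist S = l :=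
  ((Nat.mono_cast (α := ℕ∞)).map_isLeast h).isGLB.sInf_eq

theorem SynchronizesOn.exists_isSyncLength {S : Set Q} (h : M.SynchronizesOn S) :
    ∃ l, M.IsSyncLength S l :=
  ⟨_, Nat.sInf_mem h, fun _ hl => Nat.sInf_le hl⟩

theorem synchronizesOn_iff {S : Set Q} : M.SynchronizesOn S ↔ M.dist S ≠ ⊤ := by
  constructor
  · rintro ⟨l, hl⟩
    exact ne_top_of_le_ne_top (ENat.natCast_ne_top l) hl.dist_le
  · intro h
    by_contra hne
    apply h
    have : {l | M.SynchronizesOnIn S l} = ∅ :=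
      Set.eq_empty_iff_forall_notMem.2 fun l hl => hne ⟨l, hl⟩
    rw [dist, this, Set.image_empty, sInf_empty]

theorem isSyncLength_iff {S : Set Q} {l : ℕ} : M.IsSyncLength S l ↔ M.dist S = l := by
  refine ⟨IsSyncLength.dist_eq, fun h => ?_⟩
  obtain ⟨m, hm⟩ := (synchronizesOn_iff.2 (h ▸ ENat.natCast_ne_top l)).exists_isSyncLength
  have : m = l := by exact_mod_cast hm.dist_eq.symm.trans h
  exact this ▸ hm

theorem evalSet_mono {S T : Set Q} (h : S ⊆ T) (w : List A) : M.evalSet S w ⊆ M.evalSet T w := by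
  induction w generalizing S T with
  | nil => exact h
  | cons x w ih => exact ih (Set.image_mono h)

theorem evalSet_nonempty {S : Set Q} (h : S.Nonempty) (w : List A) : (M.evalSet S w).Nonempty := by
  induction w generalizing S with
  | nil => exact h
  | cons x w ih => exact ih (h.image _)

theorem SynchronizesOnIn.mono {S T : Set Q} (hS : S.Nonempty) (h : S ⊆ T) {l : ℕ}
    (hT : M.SynchronizesOnIn T l) : M.SynchronizesOnIn S l := by
  obtain ⟨w, hw, h1⟩ := hT
  obtain ⟨q, hq⟩ := Set.ncard_eq_one.1 h1
  refine ⟨w, hw, Set.ncard_eq_one.2 ⟨q, ?_⟩⟩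
  exact (evalSet_nonempty hS w).subset_singleton_iff.1 (hq ▸ evalSet_mono h w)

theorem SynchronizesOnIn.cons {S : Set Q} {x : A} {l : ℕ}
    (h : M.SynchronizesOnIn (M.stepSet S x) l) : M.SynchronizesOnIn S (l + 1) := by
  obtain ⟨w, hw, h1⟩ := h
  exact ⟨x :: w, by simp [hw], h1⟩

theorem SynchronizesOnIn.exists_stepSet {S : Set Q} {l : ℕ} (h : M.SynchronizesOnIn S (l + 1)) :
    ∃ x, M.SynchronizesOnIn (M.stepSet S x) l := by
  obtain ⟨_ | ⟨x, w⟩, hw, h1⟩ := h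
  · simp at hw
  · exact ⟨x, w, by simpa using hw, h1⟩

variable (M)

theorem isDist : IsDist (Set.range fun x q => M.step q x) M.dist := by
  have hstep : ∀ (x : A) (S : Set Q), M.dist S ≤ M.dist (M.stepSet S x) + 1 := by
    intro x S
    by_cases h : M.dist (M.stepSet S x) = ⊤
    · simp [h]
    · obtain ⟨l, hl⟩ := (synchronizesOn_iff.2 h).exists_isSyncLength
      rw [hl.dist_eq]
      exact_mod_cast (SynchronizesOnIn.cons hl.1).dist_le
  refine ⟨fun q => ?_, fun S h => ?_, fun S T hS hST => ?_, ?_, fun S k h => ?_⟩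
  · have : M.SynchronizesOnIn {q} 0 := ⟨[], rfl, Set.ncard_singleton q⟩
    simpa using this.dist_le
  · obtain ⟨⟨w, hw, h1⟩, -⟩ := isSyncLength_iff.2 (show M.dist S = (0 : ℕ) by simpa using h)
    rw [List.length_eq_zero_iff.1 hw] at h1
    exact Set.ncard_eq_one.1 h1
  · exact sInf_le_sInf (Set.image_mono fun l hl => hl.mono hS hST)
  · rintro _ S ⟨x, rfl⟩
    exact hstep x S
  · have h' : M.dist S = (k + 1 : ℕ) := by exact_mod_cast h
    obtain ⟨x, hx⟩ := (isSyncLength_iff.2 h').1.exists_stepSet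
    refine ⟨_, ⟨x, rfl⟩, le_antisymm hx.dist_le ?_⟩
    have := hstep x S
    rw [h] at this
    exact (ENat.add_le_add_iff_right ENat.one_ne_top).1 this

variable {M}

theorem IsSyncLength.le_table [Finite Q] {n k : ℕ} (hk : 2 ≤ k) (hkn : k ≤ n) (hn : n ≤ 5)
    (hQ : Nat.card Q = n) {S : Set Q} (hS : S.ncard = k) {l : ℕ} (h : M.IsSyncLength S l) :
    l ≤ syncTable n k := by
  classical
  have := Fintype.ofFinite Q
  refine M.isDist.le_table hk hkn hn (by rwa [Nat.card_eq_fintype_card] at hQ) (s := S.toFinset)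
    (by rwa [Set.ncard_eq_toFinset_card'] at hS) ?_
  rw [Set.coe_toFinset]
  exact h.dist_eq

theorem IsSyncLength.lt_table [Finite Q] {n k : ℕ} (hk : 2 ≤ k) (hkn : k ≤ n) (hn : n ≤ 5)
    (hQ : Nat.card Q = n) {S : Set Q} (hS : S.ncard = k) {l : ℕ} (h : M.IsSyncLength S l)
    (hM : ¬ M.Synchronizing) : l < syncTable n k := by
  classical
  have := Fintype.ofFinite Q
  rw [Nat.card_eq_fintype_card] at hQ
  obtain ⟨D, hD, hDt⟩ : ∃ D : Finset Q, D.card = 2 ∧ M.dist D = ⊤ := by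
    by_contra hne
    push Not at hne
    refine hM (synchronizesOn_iff.2 ?_)
    have hne' : (Finset.univ : Finset Q).Nonempty :=
      Finset.card_pos.1 (by rw [Finset.card_univ]; omega)
    simpa using M.isDist.live_of_pairs hne hne'
  refine M.isDist.lt_table hk hkn hn hQ hD hDt (s := S.toFinset)
    (by rwa [Set.ncard_eq_toFinset_card'] at hS) ?_
  rw [Set.coe_toFinset]
  exact h.dist_eq

end Distance

/-! ### Lower bounds from the Černý automaton. -/

section Reach

variable {Q : Type u} [DecidableEq Q] (M : SyncDFA Q Bool)

/-- The images of the members of `C` under the words of length `l`. -/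
def reach (C : Finset (Finset Q)) : ℕ → Finset (Finset Q)
  | 0 => C
  | l + 1 => reach ((C.image fun s => s.image fun q => M.step q true) ∪
      C.image fun s => s.image fun q => M.step q false) l

theorem mem_reach {C : Finset (Finset Q)} {l : ℕ} {t : Finset Q} :
    t ∈ M.reach C l ↔ ∃ s ∈ C, ∃ w : List Bool, w.length = l ∧ M.evalSet s w = t := by
  induction l generalizing C with
  | zero =>
    simp only [reach, List.length_eq_zero_iff, exists_eq_left, evalSet, Finset.coe_inj]
    simp
  | succ l ih =>
    rw [reach, ih]
    constructor
    · rintro ⟨s, hs, w, hw, ht⟩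
      rcases Finset.mem_union.1 hs with hs | hs <;> obtain ⟨s, hsC, rfl⟩ := Finset.mem_image.1 hs
      · exact ⟨s, hsC, true :: w, by simp [hw], by simpa [evalSet, stepSet] using ht⟩
      · exact ⟨s, hsC, false :: w, by simp [hw], by simpa [evalSet, stepSet] using ht⟩
    · rintro ⟨s, hsC, _ | ⟨x, w⟩, hw, ht⟩
      · simp at hw
      · refine ⟨s.image fun q => M.step q x, ?_, w, by simpa using hw,
          by simpa [evalSet, stepSet] using ht⟩
        cases x <;> simp only [Finset.mem_union, Finset.mem_image]
        · exact Or.inr ⟨s, hsC, rfl⟩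
        · exact Or.inl ⟨s, hsC, rfl⟩

/-- Makes the lower bounds computable: `reach` identifies equal images, so it handles at most `2 ^
n` sets instead of `2 ^ l` words. -/
theorem synchronizesOnIn_iff [Finite Q] {s : Finset Q} {l : ℕ} :
    M.SynchronizesOnIn s l ↔ ∃ t ∈ M.reach {s} l, t.card = 1 := by
  constructor
  · rintro ⟨w, hw, h1⟩
    refine ⟨(Set.toFinite (M.evalSet s w)).toFinset, M.mem_reach.2 ⟨s, by simp, w, hw, by simp⟩, ?_⟩
    rwa [Set.ncard_eq_toFinset_card _ (Set.toFinite _)] at h1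
  · rintro ⟨t, ht, h1⟩
    obtain ⟨s', hs', w, hw, hwt⟩ := M.mem_reach.1 ht
    rw [Finset.mem_singleton.1 hs'] at hwt
    exact ⟨w, hw, by rw [hwt, Set.ncard_coe_finset, h1]⟩

theorem isSyncLength_of_reach [Finite Q] {s : Finset Q} {l : ℕ}
    (h : ∃ t ∈ M.reach {s} l, t.card = 1)
    (hlt : ∀ i < l, ∀ t ∈ M.reach {s} i, t.card ≠ 1) : M.IsSyncLength s l := by
  refine ⟨M.synchronizesOnIn_iff.2 h, fun i hi => ?_⟩
  by_contra hil
  obtain ⟨t, ht, h1⟩ := M.synchronizesOnIn_iff.1 hi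
  exact hlt i (not_le.1 hil) t ht h1

end Reach

section Transport

variable {Q A : Type*} {R B : Type*} {M : SyncDFA Q A} {M' : SyncDFA R B}

theorem evalSet_image (e : Q → R) (a : A → B)
    (h : ∀ q x, M'.step (e q) (a x) = e (M.step q x)) (S : Set Q) (w : List A) :
    M'.evalSet (e '' S) (w.map a) = e '' M.evalSet S w := by
  induction w generalizing S with
  | nil => rfl
  | cons x w ih =>
    rw [List.map_cons, evalSet, evalSet, ← ih]
    congr 1
    simp only [stepSet, Set.image_image, h]

/-- Used to move the Černý automaton to arbitrary universes. -/
theorem synchronizesOnIn_image {e : Q → R} (he : Function.Injective e) (a : A ≃ B)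
    (h : ∀ q x, M'.step (e q) (a x) = e (M.step q x)) (S : Set Q) (l : ℕ) :
    M'.SynchronizesOnIn (e '' S) l ↔ M.SynchronizesOnIn S l := by
  constructor
  · rintro ⟨w, hw, h1⟩
    refine ⟨w.map a.symm, by simpa using hw, ?_⟩
    have := evalSet_image e a h S (w.map a.symm)
    rw [List.map_map, Equiv.self_comp_symm, List.map_id] at this
    rwa [this, Set.ncard_image_of_injective _ he] at h1
  · rintro ⟨w, hw, h1⟩
    refine ⟨w.map a, by simpa using hw, ?_⟩
    rwa [evalSet_image e a h, Set.ncard_image_of_injective _ he]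

end Transport

theorem exists_cerny {n k : ℕ} (hk : 2 ≤ k) (hkn : k ≤ n) (hn : n ≤ 5) :
    ∃ s : Finset (Fin n), s.card = k ∧ (cerny n).IsSyncLength s (syncTable n k) := by
  have key : ∀ s : Finset (Fin n), s.card = k ∧
      (∃ t ∈ (cerny n).reach {s} (syncTable n k), t.card = 1) ∧
      (∀ i < syncTable n k, ∀ t ∈ (cerny n).reach {s} i, t.card ≠ 1) →
      ∃ s : Finset (Fin n), s.card = k ∧ (cerny n).IsSyncLength s (syncTable n k) :=
    fun s hs => ⟨s, hs.1, isSyncLength_of_reach _ hs.2.1 hs.2.2⟩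
  interval_cases n <;> interval_cases k
  · exact key Finset.univ (by decide +kernel)
  · exact key {0, 1} (by decide +kernel)
  · exact key Finset.univ (by decide +kernel)
  · exact key {0, 2} (by decide +kernel)
  · exact key {0, 1, 2} (by decide +kernel)
  · exact key Finset.univ (by decide +kernel)
  · exact key {0, 2} (by decide +kernel)
  · exact key {0, 2, 3} (by decide +kernel)
  · exact key {0, 1, 2, 3} (by decide +kernel)
  · exact key Finset.univ (by decide +kernel)

theorem syncTable_mem_subsetSyncLengths {n k : ℕ} (hk : 2 ≤ k) (hkn : k ≤ n) (hn : n ≤ 5) :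
    syncTable n k ∈ subsetSyncLengths.{u, v} n k := by
  obtain ⟨s, hs, hl⟩ := exists_cerny hk hkn hn
  let M : SyncDFA (ULift.{u} (Fin n)) (ULift.{v} Bool) :=
    ⟨fun q x => ⟨(cerny n).step q.down x.down⟩⟩
  refine ⟨ULift.{u} (Fin n), ULift.{v} Bool, inferInstance, M, ULift.up '' (s : Set (Fin n)),
    by simp, ?_, ?_⟩
  · rw [Set.ncard_image_of_injective _ ULift.up_injective, Set.ncard_coe_finset, hs]
  · have : {l | M.SynchronizesOnIn (ULift.up '' (s : Set (Fin n))) l} =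
        {l | (cerny n).SynchronizesOnIn s l} := Set.ext fun l =>
      synchronizesOnIn_image ULift.up_injective Equiv.ulift.symm (fun _ _ => rfl) _ _
    rw [IsSyncLength, this]
    exact hl

end SyncDFA

theorem mainTheorem10 (n k : ℕ) (hk : 2 ≤ k) (hkn : k ≤ n) (hn : n ≤ 5) :
    (∀ (Q : Type u) (A : Type v) [Finite Q] (M : SyncDFA Q A) (S : Set Q),
      Nat.card Q = n → S.ncard = k → M.SynchronizesOn S → ¬ M.Synchronizing →
        ∃ l : ℕ, M.IsSyncLength S l ∧ l < SyncDFA.syncTable n k) ∧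
    IsGreatest (SyncDFA.subsetSyncLengths.{u, v} n k) (SyncDFA.syncTable n k) ∧
    IsGreatest {l : ℕ | ∃ S : Set (Fin n), S.ncard = k ∧ (SyncDFA.cerny n).IsSyncLength S l}
      (SyncDFA.syncTable n k) := by
  refine ⟨fun Q A _ M S hQ hS hsync hM => ?_,
    ⟨SyncDFA.syncTable_mem_subsetSyncLengths hk hkn hn, ?_⟩, ?_, ?_⟩
  · obtain ⟨l, hl⟩ := hsync.exists_isSyncLength
    exact ⟨l, hl, hl.lt_table hk hkn hn hQ hS hM⟩
  · rintro l ⟨Q, A, _, M, S, hQ, hS, hl⟩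
    exact hl.le_table hk hkn hn hQ hS
  · obtain ⟨s, hs, hl⟩ := SyncDFA.exists_cerny hk hkn hn
    exact ⟨s, by rw [Set.ncard_coe_finset, hs], hl⟩
  · rintro l ⟨S, hS, hl⟩
    exact hl.le_table hk hkn hn (Nat.card_fin n) hS
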